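/- Let $k$ be a field of characteristic $0$, let $\mathcal B$ be a normal integral projective $k$-variety (of any dimension) with a fixed closed embedding $\iota:\mathcal B\hookrightarrow\mathbb P^N_k$, and let $\mathbf K=k(\mathcal B)$ be its function field, with algebraic closure $\bar{\mathbf K}$. Heights. For a point $P=[x_0:x_1:x_2]\in\mathbb P^2(\bar{\mathbf K})$ with coordinates generating a finite extension $L$ of $\mathbf K$, let $\mathcal B_L\to\mathcal B$ be the normalization of $\mathcal B$ in $L$ and put \[ h(P)=\frac1{[L:\mathbf K]}\sum_{W}\deg(W)\,\max_{i}\bigl(-\operatorname{ord}_W(x_i)\bigr), \] where $W$ runs over the prime divisors of $\mathcal B_L$ and $\deg(W)$ is the degree of $W$ with respect to the pull-back of $\iota^*\mathcal O(1)$, i.e. the residue degree of $W$ over its image $V\subset\mathcal B$ times the degree of $V$ in $\mathbb P^N_k$. For $z=(x,y)\in\mathbb A^2(\bar{\mathbf K})$ put $h(z)=h([x:y:1])$. Regular automorphisms. Let $f=(p,q)$ be a polynomial automorphism of $\mathbb A^2$ defined over $\mathbf K$, of degree $d=\max(\deg p,\deg q)\ge 2$. Assume that $f$ is regular: the extensions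 of $f$ and of $f^{-1}$ to rational self-maps of $\mathbb P^2$ have unique indeterminacy points $I^+$ and $I^-$ respectively, and $I^+\neq I^-$. Then for every $z\in\mathbb A^2(\bar{\mathbf K})$ the limits \[ \widehat h_f^{+}(z)=\lim_{n\to+\infty}d^{-n}h(f^{n}(z)),\qquad \widehat h_f^{-}(z)=\lim_{n\to+\infty}d^{-n}h(f^{-n}(z)) \] exist in $\mathbb R$, and, with $\widehat h_f=\widehat h_f^{+}+\widehat h_f^{-}$, there is a constant $C>0$, independent of $z$, such that \[ \widehat h_f(z)\ \ge\ h(z)-C\qquad\text{for all } z\in\mathbb A^2(\bar{\mathbf K}). \] -/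

import Mathlib

open AlgebraicGeometry MvPolynomial Filter Topology
open scoped WithZero Nat

universe u v

noncomputable section

/-! ### Polynomial automorphisms of the affine plane -/

namespace PlaneDynamics

/-- A polynomial automorphism `(x, y) ↦ (p(x, y), q(x, y))` of the affine plane over `F`, given by
its comorphism: the `F`-algebra automorphism of `F[x, y]` sending `x` to `p` and `y` to `q`. -/
abbrev PlaneAut (F : Type u) [Field F] : Type u :=
  MvPolynomial (Fin 2) F ≃ₐ[F] MvPolynomial (Fin 2) F

/-- The two coordinate polynomials `p`, `q` of a plane automorphism. -/
def PlaneAut.component {F : Type u} [Field F] (f : PlaneAut F) (i : Fin 2) :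
    MvPolynomial (Fin 2) F :=
  f (X i)

/-- The degree `max (deg p) (deg q)`. -/
def PlaneAut.degree {F : Type u} [Field F] (f : PlaneAut F) : ℕ :=
  max (f.component 0).totalDegree (f.component 1).totalDegree

/-- The action of a plane automorphism on points with coordinates in an extension `E` of `F`. The
inverse map is the action of `f.symm`. -/
def PlaneAut.act {F : Type u} [Field F] (f : PlaneAut F) {E : Type v} [Field E] [Algebra F E]
    (z : Fin 2 → E) : Fin 2 → E :=
  fun i => aeval z (f.component i)

/-- The homogenization of degree `n` (for `n ≥ deg p`): `t ^ n * p (x / t, y / t)`. -/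
def homogenization {F : Type u} [Field F] (n : ℕ) (p : MvPolynomial (Fin 2) F) :
    MvPolynomial (Fin 3) F :=
  ∑ m ∈ p.support, C (coeff m p) * X 0 ^ m 0 * X 1 ^ m 1 * X 2 ^ (n - (m 0 + m 1))

/-- Homogeneous coordinates of the extension of `f` to a rational self-map of the projective plane;
the affine point `(x, y)` is `[x : y : 1]`. -/
def PlaneAut.extension {F : Type u} [Field F] (f : PlaneAut F) : Fin 3 → MvPolynomial (Fin 3) F :=
  ![homogenization f.degree (f.component 0), homogenization f.degree (f.component 1),
    X 2 ^ f.degree]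

/-- The (geometric) indeterminacy points of the extension of `f` to the projective plane. The three
coordinates of the extension have no common factor, so these are their common zeros. -/
def PlaneAut.indeterminacy {F : Type u} [Field F] (f : PlaneAut F) :
    Set (Projectivization (AlgebraicClosure F) (Fin 3 → AlgebraicClosure F)) :=
  {P | ∀ i, aeval P.rep (f.extension i) = 0}

/-- `f` is regular: the extensions of `f` and of its inverse to the projective plane each have a
unique indeterminacy point, and these two points are distinct. -/
def PlaneAut.IsRegular {F : Type u} [Field F] (f : PlaneAut F) : Prop :=
  ∃ Iplus Iminus, f.indeterminacy = {Iplus} ∧ PlaneAut.indeterminacy f.symm = {Iminus} ∧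
    Iplus ≠ Iminus

/-! ### Degrees of subvarieties of projective space -/

/-- The grading of the polynomial ring by the degree. -/
instance polynomialGrading (k : Type u) [Field k] (N : ℕ) :
    GradedAlgebra (homogeneousSubmodule (Fin (N + 1)) k) :=
  MvPolynomial.gradedAlgebra

/-- The projective space of dimension `N` over `k`, as a scheme. -/
abbrev ProjSpace (k : Type u) [Field k] (N : ℕ) : Scheme.{u} :=
  Proj (homogeneousSubmodule (Fin (N + 1)) k)

/-- The homogeneous prime ideal of `k[X₀, …, X_N]` corresponding to a point of projective space,
that is the homogeneous ideal of the closure of that point. -/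
def pointIdeal {k : Type u} [Field k] {N : ℕ} (P : ProjSpace k N) :
    Ideal (MvPolynomial (Fin (N + 1)) k) :=
  (show ProjectiveSpectrum (homogeneousSubmodule (Fin (N + 1)) k) from
    P).asHomogeneousIdeal.toIdeal

/-- The Hilbert function `n ↦ dim_k (k[X]/I)_n` of an ideal `I` of `k[X₀, …, X_N]`. -/
def hilbertFunction {k : Type u} [Field k] {N : ℕ} (I : Ideal (MvPolynomial (Fin (N + 1)) k))
    (n : ℕ) : ℕ :=
  Module.finrank k (homogeneousSubmodule (Fin (N + 1)) k n ⧸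
    (I.restrictScalars k).submoduleOf (homogeneousSubmodule (Fin (N + 1)) k n))

/-- `P` is the Hilbert polynomial of `I`. -/
def IsHilbertPolynomial {k : Type u} [Field k] {N : ℕ}
    (I : Ideal (MvPolynomial (Fin (N + 1)) k)) (P : Polynomial ℚ) : Prop :=
  ∀ᶠ n : ℕ in atTop, P.eval (n : ℚ) = hilbertFunction I n

open Classical in
/-- The degree of the closure of a point of projective space: `r!` times the leading coefficient of
its Hilbert polynomial, `r` being the degree of that polynomial. -/
def pointDegree {k : Type u} [Field k] {N : ℕ} (P : ProjSpace k N) : ℚ :=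
  if h : ∃ Q, IsHilbertPolynomial (pointIdeal P) Q then
    (h.choose.natDegree ! : ℚ) * h.choose.leadingCoeff
  else 0

/-! ### Heights over the function field of a normal projective variety -/

/-- A scheme is normal: all its local rings are integrally closed domains. -/
def IsNormalScheme (B : Scheme.{u}) : Prop :=
  ∀ x : B, IsDomain (B.presheaf.stalk x) ∧ IsIntegrallyClosed (B.presheaf.stalk x)

/-- For an algebraic extension `L` of the function field `K` of `B`: a discrete valuation ring
of `L` lying over the local ring of `B` at (the generic point of) a prime divisor. For `B` normal
and `L` finite over `K`, these are the local rings at the prime divisors of the normalization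
of `B` in `L`. -/
structure DivisorPlace (B : Scheme.{u}) [IsIntegral B] (L : Type v) [Field L]
    [Algebra B.functionField L] where
  /-- the generic point of the prime divisor of `B` below the place -/
  point : B
  codim_one : ringKrullDim (B.presheaf.stalk point) = 1
  /-- the valuation ring of the place -/
  ring : ValuationSubring L
  isDVR : IsDiscreteValuationRing ring
  lies_over : ∀ a : B.functionField, algebraMap B.functionField L a ∈ ring ↔
    a ∈ Set.range (algebraMap (B.presheaf.stalk point) B.functionField)

namespace DivisorPlace

variable {B : Scheme.{u}} [IsIntegral B] {L : Type v} [Field L] [Algebra B.functionField L]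

instance (w : DivisorPlace B L) : IsDiscreteValuationRing w.ring := w.isDVR

/-- The inclusion of the local ring of `B` in the valuation ring of a place over it. -/
def stalkHom (w : DivisorPlace B L) : B.presheaf.stalk w.point →+* w.ring :=
  ((algebraMap B.functionField L).comp
    (algebraMap (B.presheaf.stalk w.point) B.functionField)).codRestrict w.ring.toSubring
    fun a => (w.lies_over _).2 ⟨a, rfl⟩

instance (w : DivisorPlace B L) : Algebra (B.presheaf.stalk w.point) w.ring :=
  w.stalkHom.toAlgebra

/-- The residue degree of the place over the prime divisor below it. -/
def residueDegree (w : DivisorPlace B L) : ℕ :=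
  (IsLocalRing.maximalIdeal w.ring).inertiaDeg (B.presheaf.stalk w.point)

/-- The normalized discrete valuation of the place, written multiplicatively:
`w.valuation a = exp (-ord_w a)`. -/
def valuation (w : DivisorPlace B L) : Valuation L ℤᵐ⁰ :=
  (IsDiscreteValuationRing.maximalIdeal w.ring).valuation L

/-- `max_i (-ord_w (x i))`, for a nonzero vector `x`. -/
def localHeight (w : DivisorPlace B L) (x : Fin 3 → L) : ℤ :=
  WithZero.log (Finset.univ.sup fun i => w.valuation (x i))

end DivisorPlace

/-- The height of the point of the projective plane with homogeneous coordinates `x i` in a finite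
extension `L` of the function field `K` of `B`, with respect to the projective embedding `ι`:
`[L : K]⁻¹ * ∑_w deg(w) * max_i (-ord_w (x i))`, where `w` runs over the prime divisors of the
normalization of `B` in `L` and `deg(w)` is the degree of `w` for the pull-back of `O(1)`, that is
the degree of the image of `w` in `B` times the residue degree. -/
def heightOver {k : Type u} [Field k] {N : ℕ} {B : Scheme.{u}} [IsIntegral B]
    (ι : B ⟶ ProjSpace k N) (L : Type v) [Field L] [Algebra B.functionField L]
    (x : Fin 3 → L) : ℝ :=
  (∑ᶠ w : DivisorPlace B L,
    ((pointDegree (ι w.point) : ℚ) : ℝ) * (w.residueDegree : ℝ) * (w.localHeight x : ℝ)) /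
    (Module.finrank B.functionField L : ℝ)

/-- The absolute height of a vector of homogeneous coordinates in the algebraic closure of the
function field of `B`, computed over the field generated by these coordinates. -/
def projHeight {k : Type u} [Field k] {N : ℕ} {B : Scheme.{u}} [IsIntegral B]
    (ι : B ⟶ ProjSpace k N) (x : Fin 3 → AlgebraicClosure B.functionField) : ℝ :=
  heightOver ι (IntermediateField.adjoin B.functionField (Set.range x))
    fun i => ⟨x i, IntermediateField.subset_adjoin _ _ ⟨i, rfl⟩⟩

/-- The standard height of a point `(x, y)` of the affine plane: the height of `[x : y : 1]`. -/
def height {k : Type u} [Field k] {N : ℕ} {B : Scheme.{u}} [IsIntegral B]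
    (ι : B ⟶ ProjSpace k N) (z : Fin 2 → AlgebraicClosure B.functionField) : ℝ :=
  projHeight ι ![z 0, z 1, 1]

/-! ### Canonical heights -/

/-- The sequence `d ^ (-n) * h (f ^ n z)`, where `d = deg f`. -/
def forwardSeq {k : Type u} [Field k] {N : ℕ} {B : Scheme.{u}} [IsIntegral B]
    (ι : B ⟶ ProjSpace k N) (f : PlaneAut B.functionField)
    (z : Fin 2 → AlgebraicClosure B.functionField) (n : ℕ) : ℝ :=
  height ι (f.act^[n] z) / (f.degree : ℝ) ^ n

/-- The sequence `d ^ (-n) * h (f ^ (-n) z)`, where `d = deg f`. -/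
def backwardSeq {k : Type u} [Field k] {N : ℕ} {B : Scheme.{u}} [IsIntegral B]
    (ι : B ⟶ ProjSpace k N) (f : PlaneAut B.functionField)
    (z : Fin 2 → AlgebraicClosure B.functionField) (n : ℕ) : ℝ :=
  height ι ((PlaneAut.act f.symm)^[n] z) / (f.degree : ℝ) ^ n

/-- The forward canonical height. -/
def canonicalHeightPlus {k : Type u} [Field k] {N : ℕ} {B : Scheme.{u}} [IsIntegral B]
    (ι : B ⟶ ProjSpace k N) (f : PlaneAut B.functionField)
    (z : Fin 2 → AlgebraicClosure B.functionField) : ℝ :=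
  limUnder atTop (forwardSeq ι f z)

/-- The backward canonical height. -/
def canonicalHeightMinus {k : Type u} [Field k] {N : ℕ} {B : Scheme.{u}} [IsIntegral B]
    (ι : B ⟶ ProjSpace k N) (f : PlaneAut B.functionField)
    (z : Fin 2 → AlgebraicClosure B.functionField) : ℝ :=
  limUnder atTop (backwardSeq ι f z)

/-- The canonical height, the sum of the forward and the backward one. -/
def canonicalHeight {k : Type u} [Field k] {N : ℕ} {B : Scheme.{u}} [IsIntegral B]
    (ι : B ⟶ ProjSpace k N) (f : PlaneAut B.functionField)
    (z : Fin 2 → AlgebraicClosure B.functionField) : ℝ :=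
  canonicalHeightPlus ι f z + canonicalHeightMinus ι f z

end PlaneDynamics

end

/-! The inequality is proved place by place and then summed. At a place `w`, put `‖z‖ = max(|z 0|,
|z 1|, 1)` and let `A` bound 1 and the coefficients of `f`, of its inverse and of certain Bézout
multipliers. The ultrametric inequality gives `log ‖f z‖ ≤ d log ‖z‖ + log A`, and likewise for the
inverse (`logGauge_aeval_le`). Regularity says that the top forms of `f` and of its inverse have no
common zero at infinity. A Bézout identity between them then shows that at each point one of the two
maps satisfies the reverse inequality, with error `2 d log A` (`le_logGauge_aeval`). This needs the
inverse to have the same degree `d`, which follows by counting intersections of a line with the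
preimage of another line (`PlaneAut.degree_symm`).

Such an alternative is enough to run the dynamics: a point that is large and expanded by one map
keeps being expanded by it, so the normalized logarithms converge geometrically, and an orbit that
never reaches this regime stays bounded. Hence the local limits exist and their sum is at least `log
‖z‖ - 2 d log A` (`ExpandingDynamics.exists_tendsto_and_le_add`).

To globalize, all iterates of `z` generate the same field `L = K(z)`, so only places of `L` matter,
and outside a finite set of them the whole orbit contributes zero; limits therefore pass through the
sum. The total error is uniform in `z`: at a place over a prime divisor `x`, `log A` is a pole order
at `x` times the ramification index, and the fundamental inequality `∑ e f ≤ [L : K]` makes the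
weighted sum at most `[L : K]` times the degree of a fixed divisor
(`DenominatorBound.sum_le_degree`). The normalization of the height cancels `[L : K]`. -/

/-! ### Heights with respect to which a map or its inverse is expanding -/

namespace ExpandingDynamics

variable {X : Type*} {f g : X → X} {H : X → ℝ} {d c : ℝ}

/-- A point is escaping if its height exceeds `c` and is multiplied by `d` up to an error `c`. -/
def Escaping (f : X → X) (H : X → ℝ) (d c : ℝ) (z : X) : Prop :=
  c < H z ∧ d * H z - c ≤ H (f z)

/-- Since `H (f z) > H z > c`, the map `g` cannot expand at `f z`: it would send `f z` to a point
higher than `f z`, but it sends it back to `z`. So the alternative `hA` leaves only expansion by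
`f`. -/
theorem Escaping.map (hd : 2 ≤ d) (hc : 0 ≤ c) (hgf : ∀ z, g (f z) = z)
    (hA : ∀ z, d * H z - c ≤ H (f z) ∨ d * H z - c ≤ H (g z)) {z : X}
    (hz : Escaping f H d c z) : Escaping f H d c (f z) := by
  obtain ⟨h1, h2⟩ := hz
  have h3 : c < H (f z) := by nlinarith
  refine ⟨h3, (hA (f z)).resolve_right fun h => ?_⟩
  rw [hgf] at h
  nlinarith

theorem Escaping.exists_tendsto (hd : 2 ≤ d) (hc : 0 ≤ c) (hgf : ∀ z, g (f z) = z)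
    (hA : ∀ z, d * H z - c ≤ H (f z) ∨ d * H z - c ≤ H (g z))
    (hf : ∀ z, H (f z) ≤ d * H z + c) {z : X} (hz : Escaping f H d c z) :
    ∃ G, Tendsto (fun n => H (f^[n] z) / d ^ n) atTop (𝓝 G) ∧ H z - c ≤ G := by
  have hd0 : 0 < d := by linarith
  have hesc : ∀ n, Escaping f H d c (f^[n] z) := by
    intro n
    induction n with
    | zero => exact hz
    | succ n ih => rw [Function.iterate_succ_apply']; exact ih.map hd hc hgf hA
  have hdist : ∀ n, dist (H (f^[n] z) / d ^ n) (H (f^[n + 1] z) / d ^ (n + 1)) ≤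
      c / d * (1 / d) ^ n := by
    intro n
    have h1 := (hesc n).2
    have h2 := hf (f^[n] z)
    rw [Function.iterate_succ_apply']
    have : H (f^[n] z) / d ^ n - H (f (f^[n] z)) / d ^ (n + 1) =
        (d * H (f^[n] z) - H (f (f^[n] z))) / d ^ (n + 1) := by
      field_simp
      ring
    rw [Real.dist_eq, this, abs_div, abs_of_pos (pow_pos hd0 (n + 1))]
    have h3 : c / d * (1 / d) ^ n = c / d ^ (n + 1) := by
      rw [one_div, inv_pow]
      field_simp
      ring
    rw [h3]
    gcongr
    rw [abs_le]
    constructor <;> linarith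
  have hr : 1 / d < 1 := by rw [div_lt_one hd0]; linarith
  obtain ⟨G, hG⟩ := cauchySeq_tendsto_of_complete (cauchySeq_of_le_geometric _ _ hr hdist)
  refine ⟨G, hG, ?_⟩
  have h := dist_le_of_le_geometric_of_tendsto₀ _ _ hr hdist hG
  -- The total drift is the geometric sum of `c / d ^ (n + 1)`, that is `c / (d - 1)`, which `2 ≤ d`
  -- bounds by `c`.
  have h4 : c / d / (1 - 1 / d) ≤ c := by
    have : c / d / (1 - 1 / d) = c / (d - 1) := by field_simp
    rw [this]
    exact div_le_self hc (by linarith)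
  rw [Real.dist_eq, abs_le] at h
  simp only [Function.iterate_zero, id_eq, pow_zero, div_one] at h
  linarith [h.2]

theorem exists_tendsto (hd : 2 ≤ d) (hc : 0 ≤ c) (hgf : ∀ z, g (f z) = z) (hH : ∀ z, 0 ≤ H z)
    (hA : ∀ z, d * H z - c ≤ H (f z) ∨ d * H z - c ≤ H (g z))
    (hf : ∀ z, H (f z) ≤ d * H z + c) (z : X) :
    ∃ G, Tendsto (fun n => H (f^[n] z) / d ^ n) atTop (𝓝 G) := by
  have hd0 : 0 < d := by linarith
  by_cases h : ∃ m, Escaping f H d c (f^[m] z)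
  · obtain ⟨m, hm⟩ := h
    obtain ⟨G, hG, -⟩ := hm.exists_tendsto hd hc hgf hA hf
    refine ⟨G / d ^ m, (tendsto_add_atTop_iff_nat m).1 ?_⟩
    refine (hG.div_const (d ^ m)).congr fun n => ?_
    rw [Function.iterate_add_apply, pow_add, div_div]
  · push Not at h
    have hbd : ∀ n, H (f^[n] z) ≤ max (H z) c := by
      intro n
      induction n with
      | zero => exact le_max_left _ _
      | succ n ih =>
        by_cases h1 : H (f^[n + 1] z) ≤ c
        · exact h1.trans (le_max_right _ _)
        · push Not at h1
          -- A high point that does not escape is expanded by `g`, so its predecessor in the orbit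
          -- was higher still. Heights above `c` can thus only decrease, and the limit is 0.
          have h2 : d * H (f^[n + 1] z) - c ≤ H (g (f^[n + 1] z)) :=
            (hA _).resolve_left fun h3 => h (n + 1) ⟨h1, h3⟩
          rw [Function.iterate_succ_apply', hgf, ← Function.iterate_succ_apply' f] at h2
          nlinarith
    refine ⟨0, ?_⟩
    have h1 : Tendsto (fun n : ℕ => max (H z) c / d ^ n) atTop (𝓝 0) :=
      tendsto_const_nhds.div_atTop (tendsto_pow_atTop_atTop_of_one_lt (by linarith))
    refine squeeze_zero (fun n => div_nonneg (hH _) (by positivity)) (fun n => ?_) h1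
    have := hbd n
    gcongr

/-- If at every point either `f` or its inverse `g` multiplies the height by `d`, up to a bounded
error, then the forward and backward canonical heights exist and their sum bounds the height. -/
theorem exists_tendsto_and_le_add (hd : 2 ≤ d) (hc : 0 ≤ c) (hgf : ∀ z, g (f z) = z)
    (hfg : ∀ z, f (g z) = z) (hH : ∀ z, 0 ≤ H z)
    (hA : ∀ z, d * H z - c ≤ H (f z) ∨ d * H z - c ≤ H (g z))
    (hf : ∀ z, H (f z) ≤ d * H z + c) (hg : ∀ z, H (g z) ≤ d * H z + c) (z : X) :
    ∃ G G', Tendsto (fun n => H (f^[n] z) / d ^ n) atTop (𝓝 G) ∧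
      Tendsto (fun n => H (g^[n] z) / d ^ n) atTop (𝓝 G') ∧ H z - c ≤ G + G' := by
  have hA' := fun z => (hA z).symm
  obtain ⟨G, hG⟩ := exists_tendsto hd hc hgf hH hA hf z
  obtain ⟨G', hG'⟩ := exists_tendsto hd hc hfg hH hA' hg z
  have hd0 : 0 < d := by linarith
  have hG0 : 0 ≤ G := ge_of_tendsto' hG fun n => div_nonneg (hH _) (by positivity)
  have hG0' : 0 ≤ G' := ge_of_tendsto' hG' fun n => div_nonneg (hH _) (by positivity)
  refine ⟨G, G', hG, hG', ?_⟩
  -- Both limits are nonnegative, so low points are trivial. A high point escapes under one of the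
  -- two maps, and that limit alone exceeds `H z - c`.
  by_cases h : H z ≤ c
  · linarith
  · push Not at h
    rcases hA z with h1 | h1
    · obtain ⟨G₁, h2, h3⟩ := Escaping.exists_tendsto hd hc hgf hA hf ⟨h, h1⟩
      rw [tendsto_nhds_unique hG h2]
      linarith
    · obtain ⟨G₁, h2, h3⟩ := Escaping.exists_tendsto hd hc hfg hA' hg ⟨h, h1⟩
      rw [tendsto_nhds_unique hG' h2]
      linarith

end ExpandingDynamics

/-! ### Nonarchimedean estimates for polynomial maps -/

namespace NonarchimedeanEstimates

variable {K L Γ : Type*} [Field K] [Field L] [Algebra K L] [LinearOrderedCommGroupWithZero Γ]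
  {σ : Type*} [Fintype σ]

theorem valuation_aeval_le (v : Valuation L Γ) {p : MvPolynomial σ K} {n : ℕ}
    (hn : ∀ m ∈ p.support, m.degree ≤ n) {A M : Γ}
    (hA : ∀ m, v (algebraMap K L (coeff m p)) ≤ A) (hM : 1 ≤ M) {z : σ → L}
    (hz : ∀ i, v (z i) ≤ M) : v (aeval z p) ≤ A * M ^ n := by
  rw [aeval_def, eval₂_eq']
  refine v.map_sum_le fun m hm => ?_
  rw [map_mul, map_prod]
  refine mul_le_mul' (hA m) ?_
  calc ∏ i, v (z i ^ m i) ≤ ∏ i, M ^ m i :=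
        Finset.prod_le_prod' fun i _ => by
          rw [map_pow]
          exact pow_le_pow_left₀ zero_le (hz i) _
    _ = M ^ m.degree := by
        rw [Finset.prod_pow_eq_pow_sum, Finsupp.degree_eq_sum]
    _ ≤ M ^ n := pow_le_pow_right₀ hM (hn m hm)

theorem valuation_polynomial_aeval_le (v : Valuation L Γ) {a : Polynomial K} {A : Γ}
    (hA : ∀ n, v (algebraMap K L (a.coeff n)) ≤ A) {x : L} (hx : v x ≤ 1) :
    v (Polynomial.aeval x a) ≤ A := by
  rw [Polynomial.aeval_eq_sum_range]
  refine v.map_sum_le fun n _ => ?_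
  rw [Algebra.smul_def, map_mul, map_pow]
  exact (mul_le_mul' (hA n) (pow_le_one₀ zero_le hx)).trans_eq (mul_one A)

theorem valuation_aeval_sub_homogeneousComponent_le (v : Valuation L Γ)
    {p : MvPolynomial σ K} {d : ℕ} (hd : 1 ≤ d) (hp : p.totalDegree ≤ d) {A M : Γ}
    (hA : ∀ m, v (algebraMap K L (coeff m p)) ≤ A) (hM : 1 ≤ M) {z : σ → L}
    (hz : ∀ i, v (z i) ≤ M) :
    v (aeval z p - aeval z (homogeneousComponent d p)) ≤ A * M ^ (d - 1) := by
  classical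
  rw [← map_sub]
  refine valuation_aeval_le v (fun m hm => ?_) (fun m => ?_) hM hz
  · rw [mem_support_iff, coeff_sub, coeff_homogeneousComponent] at hm
    split_ifs at hm with h
    · simp at hm
    · rw [sub_zero, ← mem_support_iff] at hm
      have := (le_totalDegree hm).trans hp
      change m.degree ≤ d at this
      omega
  · rw [coeff_sub, coeff_homogeneousComponent]
    split_ifs with h
    · simp
    · simpa using hA m

/-- Dehomogenization with respect to the variable `j`, for polynomials in two variables. -/
noncomputable def chart (K : Type*) [Field K] (j : Fin 2) :
    MvPolynomial (Fin 2) K →ₐ[K] Polynomial K :=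
  aeval fun i => if i = j then 1 else Polynomial.X

theorem aeval_smul_of_isHomogeneous {p : MvPolynomial σ K} {d : ℕ} (hp : p.IsHomogeneous d)
    (t : L) (z : σ → L) : aeval (fun i => t * z i) p = t ^ d * aeval z p := by
  simp only [aeval_def, eval₂_eq', Finset.mul_sum, mul_pow, Finset.prod_mul_distrib]
  refine Finset.sum_congr rfl fun m hm => ?_
  rw [Finset.prod_pow_eq_pow_sum, ← Finsupp.degree_eq_sum,
    show m.degree = d by rw [Finsupp.degree_eq_weight_one]; exact hp (mem_support_iff.1 hm)]
  ring

theorem aeval_chart {p : MvPolynomial (Fin 2) K} {d : ℕ} (hp : p.IsHomogeneous d) {j : Fin 2}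
    {z : Fin 2 → L} (hz : z j ≠ 0) :
    aeval z p = z j ^ d * Polynomial.aeval (z (1 - j) / z j) (chart K j p) := by
  have h : Polynomial.aeval (z (1 - j) / z j) (chart K j p) =
      aeval (fun i => if i = j then 1 else z (1 - j) / z j) p := by
    rw [chart, ← AlgHom.comp_apply, comp_aeval]
    congr 2
    ext i
    split_ifs <;> simp
  rw [h, ← aeval_smul_of_isHomogeneous hp]
  congr 2
  ext i
  split_ifs with hi
  · rw [hi, mul_one]
  · rw [mul_div_cancel₀ _ hz]
    fin_cases i <;> fin_cases j <;> simp_all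

/-- If the top forms of the polynomials `p i` have no common zero at infinity, then one of the
`p i` is large at every large point. -/
theorem exists_pow_le_valuation_aeval {ι : Type*} [Fintype ι] (v : Valuation L Γ)
    {p : ι → MvPolynomial (Fin 2) K} {d : ℕ} (hd : 1 ≤ d) (hp : ∀ i, (p i).totalDegree ≤ d)
    {j : Fin 2} {a : ι → Polynomial K}
    (ha : ∑ i, a i * chart K j (homogeneousComponent d (p i)) = 1) {A : Γ} (hA1 : 1 ≤ A)
    (hAp : ∀ i m, v (algebraMap K L (coeff m (p i))) ≤ A)
    (hAa : ∀ i n, v (algebraMap K L ((a i).coeff n)) ≤ A) {z : Fin 2 → L}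
    (hzj : ∀ i, v (z i) ≤ v (z j)) (hz : A ^ 2 < v (z j)) :
    ∃ i, v (z j) ^ d ≤ A * v (aeval z (p i)) := by
  have hM : 1 ≤ v (z j) := (one_le_pow₀ hA1).trans hz.le
  have hz0 : z j ≠ 0 := by
    rw [← v.ne_zero_iff]
    exact (zero_lt_one.trans_le hM).ne'
  have hA0 : 0 < A := zero_lt_one.trans_le hA1
  set x := z (1 - j) / z j with hx
  have hvx : v x ≤ 1 := by
    rw [hx, map_div₀]
    exact div_le_one_of_le₀ (hzj _) zero_le
  -- If every top form were smaller than `1 / A` at the integral point `x`, the Bézout sum would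
  -- have valuation less than 1.
  obtain ⟨i, hi⟩ : ∃ i, 1 ≤ A *
      v (Polynomial.aeval x (chart K j (homogeneousComponent d (p i)))) := by
    by_contra! h
    have h1 : v (Polynomial.aeval x
        (∑ i, a i * chart K j (homogeneousComponent d (p i)))) < 1 := by
      rw [map_sum]
      refine v.map_sum_lt one_ne_zero fun i _ => ?_
      rw [map_mul, map_mul]
      exact (mul_le_mul_left (valuation_polynomial_aeval_le v (hAa i) hvx) _).trans_lt (h i)
    rw [ha, map_one, map_one] at h1
    exact h1.false
  have hi' : v (z j) ^ d ≤ A * v (aeval z (homogeneousComponent d (p i))) := by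
    rw [aeval_chart (homogeneousComponent_isHomogeneous d (p i)) hz0, map_mul, map_pow,
      mul_left_comm]
    exact le_mul_of_one_le_right zero_le hi
  -- With `M = v (z j)`, the lower-order terms are at most `A * M ^ (d - 1)` and the top form is at
  -- least `M ^ d / A`. The threshold `A ^ 2 < M` is what makes the top form dominate.
  have hlt : v (aeval z (p i) - aeval z (homogeneousComponent d (p i))) <
      v (aeval z (homogeneousComponent d (p i))) := by
    refine (valuation_aeval_sub_homogeneousComponent_le v hd (hp i) (hAp i) hM hzj).trans_lt ?_
    refine lt_of_mul_lt_mul_left ?_ hA0.le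
    refine lt_of_lt_of_le ?_ hi'
    rw [← mul_assoc, ← pow_two]
    calc A ^ 2 * v (z j) ^ (d - 1) < v (z j) * v (z j) ^ (d - 1) :=
          mul_lt_mul_of_pos_right hz (pow_pos (zero_lt_one.trans_le hM) _)
      _ = v (z j) ^ d := by rw [← pow_succ', Nat.sub_add_cancel hd]
  refine ⟨i, ?_⟩
  have := v.map_add_eq_of_lt_left hlt
  rw [add_sub_cancel] at this
  rwa [this]

/-- The maximum of the absolute values of the homogeneous coordinates `[z 0 : z 1 : 1]`. -/
noncomputable def affineGauge (v : Valuation L ℤᵐ⁰) (z : Fin 2 → L) : ℤᵐ⁰ :=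
  Finset.univ.sup fun i : Fin 3 => v ((![z 0, z 1, 1] : Fin 3 → L) i)

/-- The logarithm of `affineGauge`. -/
noncomputable abbrev logGauge (v : Valuation L ℤᵐ⁰) (z : Fin 2 → L) : ℤ :=
  WithZero.log (affineGauge v z)

theorem affineGauge_le_iff (v : Valuation L ℤᵐ⁰) (z : Fin 2 → L) {M : ℤᵐ⁰} :
    affineGauge v z ≤ M ↔ (∀ i, v (z i) ≤ M) ∧ 1 ≤ M := by
  simp [affineGauge, Finset.sup_le_iff, Fin.forall_fin_succ, and_assoc]

theorem one_le_affineGauge (v : Valuation L ℤᵐ⁰) (z : Fin 2 → L) : 1 ≤ affineGauge v z :=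
  ((affineGauge_le_iff v z).1 le_rfl).2

theorem valuation_le_affineGauge (v : Valuation L ℤᵐ⁰) (z : Fin 2 → L) (i : Fin 2) :
    v (z i) ≤ affineGauge v z :=
  ((affineGauge_le_iff v z).1 le_rfl).1 i

theorem affineGauge_ne_zero (v : Valuation L ℤᵐ⁰) (z : Fin 2 → L) : affineGauge v z ≠ 0 :=
  (zero_lt_one.trans_le (one_le_affineGauge v z)).ne'

theorem logGauge_nonneg (v : Valuation L ℤᵐ⁰) (z : Fin 2 → L) : 0 ≤ logGauge v z := by
  rw [← WithZero.log_one, WithZero.log_le_log one_ne_zero (affineGauge_ne_zero v z)]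
  exact one_le_affineGauge v z

theorem logGauge_eq_zero {v : Valuation L ℤᵐ⁰} {z : Fin 2 → L} (h : ∀ i, v (z i) ≤ 1) :
    logGauge v z = 0 := by
  rw [logGauge, le_antisymm ((affineGauge_le_iff v z).2 ⟨h, le_rfl⟩) (one_le_affineGauge v z),
    WithZero.log_one]

theorem logGauge_aeval_le (v : Valuation L ℤᵐ⁰) {p : Fin 2 → MvPolynomial (Fin 2) K} {d : ℕ}
    (hp : ∀ i, (p i).totalDegree ≤ d) {A : ℤᵐ⁰} (hA1 : 1 ≤ A)
    (hA : ∀ i m, v (algebraMap K L (coeff m (p i))) ≤ A) (z : Fin 2 → L) :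
    logGauge v (fun i => aeval z (p i)) ≤
      d * logGauge v z + WithZero.log A := by
  have hA0 : A ≠ 0 := (zero_lt_one.trans_le hA1).ne'
  have hM := affineGauge_ne_zero v z
  have h : affineGauge v (fun i => aeval z (p i)) ≤ A * affineGauge v z ^ d := by
    refine (affineGauge_le_iff _ _).2 ⟨fun i => ?_, ?_⟩
    · exact valuation_aeval_le v (fun m hm => (le_totalDegree hm).trans (hp i)) (hA i)
        (one_le_affineGauge v z) (valuation_le_affineGauge v z)
    · exact one_le_mul hA1 (one_le_pow₀ (one_le_affineGauge v z))
  have h1 :=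
    (WithZero.log_le_log (affineGauge_ne_zero v _) (mul_ne_zero hA0 (pow_ne_zero d hM))).2 h
  rw [WithZero.log_mul hA0 (pow_ne_zero d hM), WithZero.log_pow, nsmul_eq_mul] at h1
  linarith

/-- The error `2 * d * log A` is dictated by small points: when the gauge is at most `A ^ 2` the
left side is nonpositive and nothing is needed. Beyond that threshold the Bézout estimate in the
chart of a largest coordinate loses only `log A`. -/
theorem le_logGauge_aeval (v : Valuation L ℤᵐ⁰) {p q : Fin 2 → MvPolynomial (Fin 2) K} {d : ℕ}
    (hd : 1 ≤ d) (hp : ∀ i, (p i).totalDegree ≤ d) (hq : ∀ i, (q i).totalDegree ≤ d)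
    {a : Fin 2 → Fin 2 ⊕ Fin 2 → Polynomial K}
    (ha : ∀ j, ∑ i, a j i * chart K j (homogeneousComponent d (Sum.elim p q i)) = 1)
    {A : ℤᵐ⁰} (hA1 : 1 ≤ A)
    (hAp : ∀ i m, v (algebraMap K L (coeff m (p i))) ≤ A)
    (hAq : ∀ i m, v (algebraMap K L (coeff m (q i))) ≤ A)
    (hAa : ∀ j i n, v (algebraMap K L ((a j i).coeff n)) ≤ A) (z : Fin 2 → L) :
    d * logGauge v z - 2 * d * WithZero.log A ≤
        logGauge v (fun i => aeval z (p i)) ∨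
      d * logGauge v z - 2 * d * WithZero.log A ≤
        logGauge v (fun i => aeval z (q i)) := by
  have hA0 : A ≠ 0 := (zero_lt_one.trans_le hA1).ne'
  have hM := affineGauge_ne_zero v z
  have hα : 0 ≤ WithZero.log A := by
    rwa [← WithZero.log_one, WithZero.log_le_log one_ne_zero hA0]
  have hd' : (1 : ℤ) ≤ d := by exact_mod_cast hd
  by_cases hsmall : affineGauge v z ≤ A ^ 2
  · left
    have h1 := (WithZero.log_le_log hM (pow_ne_zero 2 hA0)).2 hsmall
    rw [WithZero.log_pow, nsmul_eq_mul] at h1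
    push_cast at h1
    have := logGauge_nonneg v fun i => aeval z (p i)
    nlinarith
  · push Not at hsmall
    obtain ⟨j, hj⟩ : ∃ j, v (z j) = affineGauge v z := by
      have h1 : affineGauge v z = max (v (z 0)) (max (v (z 1)) 1) := by
        refine le_antisymm ((affineGauge_le_iff _ _).2 ⟨fun i => ?_, by simp⟩) (by
          simp [valuation_le_affineGauge, one_le_affineGauge])
        fin_cases i <;> simp
      have h2 : 1 < affineGauge v z := (one_le_pow₀ hA1).trans_lt hsmall
      rcases max_choice (v (z 0)) (max (v (z 1)) 1) with h | h
      · exact ⟨0, by rw [h1, h]⟩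
      · rcases max_choice (v (z 1)) 1 with h' | h'
        · exact ⟨1, by rw [h1, h, h']⟩
        · rw [h1, h, h'] at h2
          exact absurd h2 (lt_irrefl _)
    have hpq : ∀ i, (Sum.elim p q i).totalDegree ≤ d := by
      rintro (i | i)
      exacts [hp i, hq i]
    have hApq : ∀ i m, v (algebraMap K L (coeff m (Sum.elim p q i))) ≤ A := by
      rintro (i | i)
      exacts [hAp i, hAq i]
    obtain ⟨i, hi⟩ := exists_pow_le_valuation_aeval v hd hpq (ha j) hA1 hApq (hAa j)
      (fun i => (valuation_le_affineGauge v z i).trans_eq hj.symm) (hj ▸ hsmall)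
    rw [hj] at hi
    have key : ∀ G : ℤᵐ⁰, v (aeval z (Sum.elim p q i)) ≤ G → G ≠ 0 →
        d * logGauge v z - 2 * d * WithZero.log A ≤ WithZero.log G := by
      intro G hG hG0
      have h1 : affineGauge v z ^ d ≤ A * G := hi.trans (mul_le_mul_right hG A)
      have h2 := (WithZero.log_le_log (pow_ne_zero d hM) (mul_ne_zero hA0 hG0)).2 h1
      rw [WithZero.log_mul hA0 hG0, WithZero.log_pow, nsmul_eq_mul] at h2
      nlinarith
    rcases i with i | i
    · exact .inl (key _ (valuation_le_affineGauge v (fun i => aeval z (p i)) i)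
        (affineGauge_ne_zero _ _))
    · exact .inr (key _ (valuation_le_affineGauge v (fun i => aeval z (q i)) i)
        (affineGauge_ne_zero _ _))

end NonarchimedeanEstimates

/-! ### A plane automorphism and its inverse have the same degree -/

namespace PlaneDynamics

open NonarchimedeanEstimates

variable {F : Type*} [Field F]

theorem homogeneousComponent_totalDegree_ne_zero {σ R : Type*} [CommSemiring R]
    {p : MvPolynomial σ R} (hp : p ≠ 0) : homogeneousComponent p.totalDegree p ≠ 0 := by
  obtain ⟨m, hm, h⟩ := Finset.exists_mem_eq_sup p.support (support_nonempty.2 hp)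
    fun m => m.sum fun _ e => e
  intro h0
  have h1 := coeff_homogeneousComponent p.totalDegree p m
  rw [h0, coeff_zero, if_pos (show m.degree = p.totalDegree from h.symm)] at h1
  exact mem_support_iff.1 hm h1.symm

/-- The restriction of polynomial functions to the line through the origin and `(t, 1)`. -/
noncomputable def restrictLine (t : F) : MvPolynomial (Fin 2) F →ₐ[F] Polynomial F :=
  aeval ![Polynomial.C t * Polynomial.X, Polynomial.X]

/-- The equation of the line through the origin and `(t, 1)`. -/
noncomputable def lineForm (t : F) : MvPolynomial (Fin 2) F :=
  X 0 - C t * X 1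

theorem restrictLine_surjective (t : F) : Function.Surjective (restrictLine t) := by
  intro g
  refine ⟨Polynomial.aeval (X 1) g, ?_⟩
  rw [← Polynomial.aeval_algHom_apply]
  simp [restrictLine]

theorem restrictLine_lineForm (t : F) : restrictLine t (lineForm t) = 0 := by
  simp [restrictLine, lineForm]

/-- Modulo the line, `x = t y`, so restricting to the line and substituting `y` for the parameter
changes no residue class. -/
theorem mem_span_lineForm {t : F} {P : MvPolynomial (Fin 2) F} (hP : restrictLine t P = 0) :
    P ∈ Ideal.span {lineForm t} := by
  have h : (Ideal.Quotient.mkₐ F (Ideal.span {lineForm t})).comp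
      ((Polynomial.aeval (X 1 : MvPolynomial (Fin 2) F)).comp (restrictLine t)) =
      Ideal.Quotient.mkₐ F (Ideal.span {lineForm t}) := by
    ext i
    fin_cases i
    · simp only [restrictLine, Fin.zero_eta, AlgHom.comp_apply, aeval_X, Matrix.cons_val_zero,
        map_mul, Polynomial.aeval_C, Polynomial.aeval_X, Ideal.Quotient.mkₐ_eq_mk]
      rw [eq_comm, ← map_mul, Ideal.Quotient.mk_eq_mk_iff_sub_mem]
      exact Ideal.subset_span rfl
    · simp [restrictLine]
  have h1 := congrArg (fun χ => χ P) h
  simp only [AlgHom.comp_apply, hP, map_zero] at h1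
  exact Ideal.Quotient.eq_zero_iff_mem.1 h1.symm

/-- Dividing by the line first leaves a quotient of `F[X]` by one polynomial: this is the affine
intersection number of a curve with a line. If `h` vanishes on the line, both sides are 0 by
convention. -/
theorem finrank_quotient_span_pair_lineForm (t : F) (h : MvPolynomial (Fin 2) F) :
    Module.finrank F (MvPolynomial (Fin 2) F ⧸ Ideal.span {h, lineForm t}) =
      (restrictLine t h).natDegree := by
  let ψ := (Ideal.Quotient.mkₐ F (Ideal.span {restrictLine t h})).comp (restrictLine t)
  have hψ : Function.Surjective ψ :=
    (Ideal.Quotient.mkₐ_surjective F _).comp (restrictLine_surjective t)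
  have hker : RingHom.ker ψ = Ideal.span {h, lineForm t} := by
    refine le_antisymm (fun P hP => ?_) ?_
    · have h1 : restrictLine t P ∈ Ideal.span {restrictLine t h} :=
        Ideal.Quotient.eq_zero_iff_mem.1 hP
      obtain ⟨b, hb⟩ := Ideal.mem_span_singleton'.1 h1
      obtain ⟨y, rfl⟩ := restrictLine_surjective t b
      have h2 : P - y * h ∈ Ideal.span {lineForm t} :=
        mem_span_lineForm (by rw [map_sub, map_mul, hb, sub_self])
      have h3 : P = P - y * h + y * h := by ring
      rw [h3]
      refine Ideal.add_mem _ (Ideal.span_mono (by simp) h2) (Ideal.mul_mem_left _ _ ?_)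
      exact Ideal.subset_span (by simp)
    · rw [Ideal.span_le]
      rintro x (rfl | rfl)
      · exact Ideal.Quotient.eq_zero_iff_mem.2 (Ideal.subset_span rfl)
      · change ψ _ = 0
        rw [AlgHom.comp_apply, restrictLine_lineForm, map_zero]
  rw [← hker, (Ideal.quotientKerAlgEquivOfSurjective hψ).toLinearEquiv.finrank_eq,
    finrank_quotient_span_eq_natDegree]

theorem restrictLine_monomial (t : F) (m : Fin 2 →₀ ℕ) (a : F) :
    restrictLine t (monomial m a) = Polynomial.monomial m.degree (a * t ^ m 0) := by
  rw [restrictLine, aeval_monomial, Finsupp.prod_fintype _ _ (by simp), Finsupp.degree_eq_sum,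
    Fin.prod_univ_two, Fin.sum_univ_two, ← Polynomial.C_mul_X_pow_eq_monomial]
  simp only [Polynomial.algebraMap_eq, Matrix.cons_val_zero, Matrix.cons_val_one, mul_pow, map_mul,
    map_pow]
  ring

theorem coeff_restrictLine (t : F) (n : ℕ) (h : MvPolynomial (Fin 2) F) :
    (restrictLine t h).coeff n = eval ![t, 1] (homogeneousComponent n h) := by
  induction h using MvPolynomial.induction_on' with
  | monomial m a =>
    rw [restrictLine_monomial, Polynomial.coeff_monomial,
      homogeneousComponent_of_mem (isHomogeneous_monomial a rfl)]
    by_cases hm : m.degree = n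
    · rw [if_pos hm, if_pos hm.symm, eval_monomial, Finsupp.prod_fintype _ _ (by simp)]
      simp
    · rw [if_neg hm, if_neg (Ne.symm hm), map_zero]
  | add p q hp hq => simp [hp, hq]

theorem natDegree_restrictLine {t : F} {h : MvPolynomial (Fin 2) F} {d : ℕ}
    (hd : h.totalDegree ≤ d) (hne : eval ![t, 1] (homogeneousComponent d h) ≠ 0) :
    (restrictLine t h).natDegree = d := by
  refine Polynomial.natDegree_eq_of_le_of_coeff_ne_zero ?_ (by rwa [coeff_restrictLine])
  rw [Polynomial.natDegree_le_iff_coeff_eq_zero]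
  intro n hn
  rw [coeff_restrictLine, homogeneousComponent_eq_zero _ _ (hd.trans_lt hn), map_zero]

theorem eval_eq_eval_chart (t : F) (p : MvPolynomial (Fin 2) F) :
    eval ![t, 1] p = (chart F 1 p).eval t := by
  have h : (Polynomial.aeval t).comp (chart F 1) = aeval (R := F) ![t, 1] := by
    ext i
    fin_cases i <;> simp [chart]
  rw [← Polynomial.coe_aeval_eq_eval, ← coe_aeval_eq_eval, ← h]
  rfl

theorem chart_ne_zero [Infinite F] {p : MvPolynomial (Fin 2) F} {d : ℕ} (hp : p.IsHomogeneous d)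
    (h0 : p ≠ 0) : chart F 1 p ≠ 0 := by
  intro h
  -- The chart only controls `p` where `y ≠ 0`; the factor `y` takes care of the remaining points.
  have h1 : p * X 1 = 0 := by
    refine MvPolynomial.funext fun z => ?_
    rw [map_mul, eval_X, map_zero]
    by_cases hz : z 1 = 0
    · rw [hz, mul_zero]
    · have := aeval_chart hp hz
      rw [h, map_zero, mul_zero] at this
      rw [← coe_aeval_eq_eval, RingHom.coe_coe, this, zero_mul]
  exact (mul_ne_zero h0 (X_ne_zero 1)) h1

/-- Two linear pencils of polynomials in one variable have members with parameters avoiding the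
roots of each other. -/
theorem exists_eval_pencil_ne_zero [Infinite F] {P Q P' Q' : Polynomial F}
    (h : P ≠ 0 ∨ Q ≠ 0) (h' : P' ≠ 0 ∨ Q' ≠ 0) :
    ∃ s t : F, P.eval t - s * Q.eval t ≠ 0 ∧ P'.eval s - t * Q'.eval s ≠ 0 := by
  have exists_coeff : ∀ {P Q : Polynomial F}, P ≠ 0 ∨ Q ≠ 0 →
      ∃ n, P.coeff n ≠ 0 ∨ Q.coeff n ≠ 0 := by
    rintro P Q (h | h)
    · obtain ⟨n, hn⟩ := Polynomial.ext_iff.not.1 h |> not_forall.1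
      exact ⟨n, .inl hn⟩
    · obtain ⟨n, hn⟩ := Polynomial.ext_iff.not.1 h |> not_forall.1
      exact ⟨n, .inr hn⟩
  have linear_ne_zero : ∀ {a b : F}, a ≠ 0 ∨ b ≠ 0 →
      Polynomial.C a - Polynomial.C b * Polynomial.X ≠ 0 := by
    rintro a b hab h0
    have h1 := congrArg (fun p => Polynomial.coeff p 0) h0
    have h2 := congrArg (fun p => Polynomial.coeff p 1) h0
    simp at h1 h2
    tauto
  have exists_eval : ∀ {p : Polynomial F}, p ≠ 0 → ∃ x, p.eval x ≠ 0 := fun {p} hp => by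
    by_contra! hx
    exact hp (Polynomial.funext fun x => by simpa using hx x)
  obtain ⟨n, hn⟩ := exists_coeff h
  obtain ⟨R, hR0, hR⟩ : ∃ R : Polynomial F, R ≠ 0 ∧
      ∀ s, R.eval s ≠ 0 → P'.eval s ≠ 0 ∨ Q'.eval s ≠ 0 := by
    rcases h' with h' | h'
    exacts [⟨P', h', fun s => .inl⟩, ⟨Q', h', fun s => .inr⟩]
  -- First `s` is chosen so that `P - s Q` is a nonzero polynomial and `P'`, `Q'` do not both vanish
  -- at `s`. Both conditions on `t` then exclude only roots of nonzero polynomials.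
  obtain ⟨s, hs⟩ := exists_eval (mul_ne_zero (linear_ne_zero hn) hR0)
  rw [Polynomial.eval_mul] at hs
  have h1 : P - Polynomial.C s * Q ≠ 0 := by
    intro h0
    have h2 := congrArg (fun p => Polynomial.coeff p n) h0
    simp only [Polynomial.coeff_sub, Polynomial.coeff_C_mul, Polynomial.coeff_zero] at h2
    refine left_ne_zero_of_mul hs ?_
    simp only [Polynomial.eval_sub, Polynomial.eval_C, Polynomial.eval_mul, Polynomial.eval_X]
    linear_combination h2
  obtain ⟨t, ht⟩ := exists_eval (mul_ne_zero h1
    (linear_ne_zero (hR s (right_ne_zero_of_mul hs))))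
  rw [Polynomial.eval_mul] at ht
  refine ⟨s, t, ?_, ?_⟩
  · simpa using left_ne_zero_of_mul ht
  · have := right_ne_zero_of_mul ht
    simp only [Polynomial.eval_sub, Polynomial.eval_C, Polynomial.eval_mul,
      Polynomial.eval_X] at this
    rwa [mul_comm]

theorem PlaneAut.component_ne_zero {F : Type u} [Field F] (f : PlaneAut F) (i : Fin 2) :
    f.component i ≠ 0 :=
  (map_ne_zero_iff f f.injective).2 (X_ne_zero i)

theorem PlaneAut.totalDegree_component_le {F : Type u} [Field F] (f : PlaneAut F) (i : Fin 2) :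
    (f.component i).totalDegree ≤ f.degree := by
  fin_cases i
  exacts [le_max_left _ _, le_max_right _ _]

/-- The dehomogenized form of degree `deg f` of a component of `f`. -/
noncomputable def PlaneAut.topForm {F : Type u} [Field F] (f : PlaneAut F) (i : Fin 2) :
    Polynomial F :=
  chart F 1 (homogeneousComponent f.degree (f.component i))

theorem PlaneAut.topForm_ne_zero {F : Type u} [Field F] [Infinite F] (f : PlaneAut F) :
    f.topForm 0 ≠ 0 ∨ f.topForm 1 ≠ 0 := by
  have h : ∀ i, (f.component i).totalDegree = f.degree → f.topForm i ≠ 0 := fun i hi =>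
    chart_ne_zero (homogeneousComponent_isHomogeneous _ _) (by
      rw [← hi]
      exact homogeneousComponent_totalDegree_ne_zero (f.component_ne_zero i))
  rcases max_choice (f.component 0).totalDegree (f.component 1).totalDegree with h' | h'
  · exact .inl (h 0 h'.symm)
  · exact .inr (h 1 h'.symm)

theorem PlaneAut.finrank_quotient_eq_degree {F : Type u} [Field F] (f : PlaneAut F) {s t : F}
    (h : (f.topForm 0).eval t - s * (f.topForm 1).eval t ≠ 0) :
    Module.finrank F (MvPolynomial (Fin 2) F ⧸ Ideal.span {f (lineForm s), lineForm t}) =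
      f.degree := by
  have hf : f (lineForm s) = f.component 0 - C s * f.component 1 := by
    simp only [lineForm, map_sub, map_mul, PlaneAut.component]
    congr 2
    exact f.commutes s
  rw [finrank_quotient_span_pair_lineForm, hf]
  refine natDegree_restrictLine ?_ ?_
  · refine (totalDegree_sub _ _).trans (max_le (f.totalDegree_component_le 0) ?_)
    refine (totalDegree_mul _ _).trans ?_
    rw [totalDegree_C, zero_add]
    exact f.totalDegree_component_le 1
  · rw [map_sub, homogeneousComponent_C_mul, map_sub, map_mul, eval_C, eval_eq_eval_chart,
      eval_eq_eval_chart]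
    exact h

/-- For suitable lines `l_s`, `l_t`, the degree of `f` is the colength of `(f l_s, l_t)` and that of
the inverse is the colength of `(f⁻¹ l_t, l_s)`. The automorphism `f` carries the second ideal to
the first. -/
theorem PlaneAut.degree_symm {F : Type u} [Field F] [Infinite F] (f : PlaneAut F) :
    PlaneAut.degree f.symm = f.degree := by
  obtain ⟨s, t, h1, h2⟩ := exists_eval_pencil_ne_zero f.topForm_ne_zero
    (PlaneAut.topForm_ne_zero f.symm)
  rw [← PlaneAut.finrank_quotient_eq_degree f h1,
    ← PlaneAut.finrank_quotient_eq_degree f.symm h2]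
  refine (Ideal.quotientEquivAlg _ _ f ?_).toLinearEquiv.finrank_eq
  rw [Ideal.map_span, Set.image_pair, Set.pair_comm]
  simp

end PlaneDynamics

/-! ### Top forms of a regular automorphism -/

namespace PlaneDynamics

open NonarchimedeanEstimates

/-- On the line at infinity only monomials without the homogenizing variable survive, so
indeterminacy there is the vanishing of top forms. -/
theorem aeval_homogenization_line_at_infinity {F : Type u} [Field F] {E : Type*} [Field E]
    [Algebra F E] {n : ℕ} {p : MvPolynomial (Fin 2) F} (hp : p.totalDegree ≤ n) {w : Fin 3 → E}
    (hw : w 2 = 0) :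
    aeval w (homogenization n p) = aeval ![w 0, w 1] (homogeneousComponent n p) := by
  rw [homogenization, homogeneousComponent_apply, map_sum, map_sum, Finset.sum_filter]
  refine Finset.sum_congr rfl fun m hm => ?_
  have hdeg : m.degree = m 0 + m 1 := by rw [Finsupp.degree_eq_sum, Fin.sum_univ_two]
  have hle : m.degree ≤ n := (le_totalDegree hm).trans hp
  simp only [map_mul, map_pow, aeval_X, hw, algHom_C]
  split_ifs with h
  · rw [← hdeg, h, Nat.sub_self, pow_zero, mul_one, aeval_monomial,
      Finsupp.prod_fintype _ _ (by simp), Fin.prod_univ_two, mul_assoc]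
    simp
  · rw [zero_pow (by omega), mul_zero]

theorem PlaneAut.mk_mem_indeterminacy {F : Type u} [Field F] (f : PlaneAut F)
    (hd : f.degree ≠ 0) {z : Fin 2 → AlgebraicClosure F}
    (hz : (![z 0, z 1, 0] : Fin 3 → AlgebraicClosure F) ≠ 0)
    (h : ∀ i, aeval z (homogeneousComponent f.degree (f.component i)) = 0) :
    Projectivization.mk (AlgebraicClosure F) ![z 0, z 1, 0] hz ∈ f.indeterminacy := by
  obtain ⟨a, ha⟩ := Projectivization.exists_smul_eq_mk_rep (AlgebraicClosure F) _ hz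
  rw [PlaneAut.indeterminacy, Set.mem_ofPred_eq, ← ha]
  have h2 : (a • (![z 0, z 1, 0] : Fin 3 → AlgebraicClosure F)) 2 = 0 := by simp
  have hvec : (![(a • (![z 0, z 1, 0] : Fin 3 → AlgebraicClosure F)) 0,
      (a • (![z 0, z 1, 0] : Fin 3 → AlgebraicClosure F)) 1] : Fin 2 → AlgebraicClosure F) =
      fun i => (a : AlgebraicClosure F) * z i := by
    ext i
    fin_cases i <;> simp [Units.smul_def]
  have key : ∀ i, aeval (a • (![z 0, z 1, 0] : Fin 3 → AlgebraicClosure F))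
      (homogenization f.degree (f.component i)) = 0 := by
    intro i
    rw [aeval_homogenization_line_at_infinity (f.totalDegree_component_le i) h2, hvec,
      aeval_smul_of_isHomogeneous (homogeneousComponent_isHomogeneous _ _), h i, mul_zero]
  intro i
  fin_cases i
  · exact key 0
  · exact key 1
  · simp [PlaneAut.extension, hd]

/-- `F[X]` is principal: a nonunit generator of the ideal of the `g i`, zero included, has a root in
the algebraic closure, which is a common zero. -/
theorem exists_sum_mul_eq_one {F : Type u} [Field F] {ι : Type*} [Fintype ι]
    {g : ι → Polynomial F}
    (hg : ∀ x : AlgebraicClosure F, ∃ i, Polynomial.aeval x (g i) ≠ 0) :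
    ∃ a : ι → Polynomial F, ∑ i, a i * g i = 1 := by
  rw [← Ideal.mem_span_range_iff_exists_fun, ← Ideal.eq_top_iff_one]
  by_contra htop
  set b := Submodule.IsPrincipal.generator (Ideal.span (Set.range g)) with hb
  have hspan : Ideal.span {b} = Ideal.span (Set.range g) := Ideal.span_singleton_generator _
  have hroot : ∃ x : AlgebraicClosure F, Polynomial.aeval x b = 0 := by
    by_cases hb0 : b = 0
    · exact ⟨0, by rw [hb0, map_zero]⟩
    · refine IsAlgClosed.exists_aeval_eq_zero _ b fun hdeg => htop ?_
      rw [← hspan, Ideal.span_singleton_eq_top]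
      exact Polynomial.isUnit_iff_degree_eq_zero.2 hdeg
  obtain ⟨x, hx⟩ := hroot
  obtain ⟨i, hi⟩ := hg x
  have hmem : g i ∈ Ideal.span {b} := hspan ▸ Ideal.subset_span ⟨i, rfl⟩
  obtain ⟨y, hy⟩ := Ideal.mem_span_singleton'.1 hmem
  exact hi (by rw [← hy, map_mul, hx, mul_zero])

/-- The top forms of a regular automorphism and of its inverse have no common zero at infinity. -/
theorem PlaneAut.IsRegular.exists_sum_mul_eq_one {F : Type u} [Field F] {f : PlaneAut F}
    (hf : f.IsRegular) {d : ℕ} (hd : d ≠ 0) (h : f.degree = d)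
    (h' : PlaneAut.degree f.symm = d) (j : Fin 2) :
    ∃ a : Fin 2 ⊕ Fin 2 → Polynomial F, ∑ i, a i * chart F j (homogeneousComponent d
      (Sum.elim f.component (PlaneAut.component f.symm) i)) = 1 := by
  refine PlaneDynamics.exists_sum_mul_eq_one fun x => ?_
  by_contra! hx
  obtain ⟨P, Q, hP, hQ, hPQ⟩ := hf
  let z : Fin 2 → AlgebraicClosure F := fun i => if i = j then 1 else x
  have hzj : z j = 1 := if_pos rfl
  have hzj' : z (1 - j) = x := by
    fin_cases j <;> simp [z]
  have hz0 : (![z 0, z 1, 0] : Fin 3 → AlgebraicClosure F) ≠ 0 := by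
    intro h0
    have h1 : z 0 = 0 := congrFun h0 0
    have h2 : z 1 = 0 := congrFun h0 1
    fin_cases j
    · exact one_ne_zero (hzj.symm.trans h1)
    · exact one_ne_zero (hzj.symm.trans h2)
  have hzero : ∀ i, aeval z (homogeneousComponent d
      (Sum.elim f.component (PlaneAut.component f.symm) i)) = 0 := by
    intro i
    rw [aeval_chart (homogeneousComponent_isHomogeneous _ _) (hzj ▸ one_ne_zero), hzj, hzj',
      div_one, hx i, mul_zero]
  have hmem := f.mk_mem_indeterminacy (h ▸ hd) hz0 fun i => h ▸ hzero (.inl i)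
  have hmem' := PlaneAut.mk_mem_indeterminacy f.symm (h' ▸ hd) hz0 fun i => h' ▸ hzero (.inr i)
  rw [hP, Set.mem_singleton_iff] at hmem
  rw [hQ, Set.mem_singleton_iff] at hmem'
  exact hPQ (hmem.symm.trans hmem')

end PlaneDynamics

/-! ### Extensions of a discrete valuation ring and the fundamental inequality -/

namespace ValuationExtension

open IsDedekindDomain

section Valuation

variable {L : Type*} [Field L] (W : ValuationSubring L) [IsDiscreteValuationRing W]

theorem valuation_le_one_iff (x : L) :
    (IsDiscreteValuationRing.maximalIdeal W).valuation L x ≤ 1 ↔ x ∈ W := by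
  refine ⟨fun h => ?_, fun h => HeightOneSpectrum.valuation_le_one _ (⟨x, h⟩ : W)⟩
  obtain ⟨a, rfl⟩ := IsDiscreteValuationRing.exists_lift_of_le_one h
  exact a.2

theorem ne_top_of_isDiscreteValuationRing : W ≠ ⊤ := by
  intro h
  obtain ⟨x, hx⟩ := (IsDiscreteValuationRing.maximalIdeal W).valuation_surjective L
    (WithZero.exp 1)
  have h1 : x ∈ W := h ▸ ValuationSubring.mem_top x
  rw [← valuation_le_one_iff, hx, ← WithZero.exp_zero, WithZero.exp_le_exp] at h1
  omega

/-- Two surjective `ℤᵐ⁰`-valued valuations with the same valuation ring are equal. -/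
theorem valuation_eq_of_isEquiv {v w : Valuation L ℤᵐ⁰} (hv : Function.Surjective v)
    (hw : Function.Surjective w) (h : v.IsEquiv w) : v = w := by
  obtain ⟨t, ht⟩ := hv (WithZero.exp 1)
  obtain ⟨s, hs⟩ := hw (WithZero.exp 1)
  have ht0 : t ≠ 0 := by rintro rfl; exact WithZero.exp_ne_zero (ht.symm.trans (map_zero v))
  -- Dividing `x` by a power of `t` gives a unit for `v`, hence for `w`, so `w` is determined by `w
  -- t`. Surjectivity of `w` then forces `w t` to be the generator greater than 1.
  have eq_zpow : ∀ x, x ≠ 0 → ∃ n : ℤ, v x = WithZero.exp n ∧ w x = w t ^ n := by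
    intro x hx
    have hx0 : v x ≠ 0 := (v.ne_zero_iff).2 hx
    refine ⟨WithZero.log (v x), (WithZero.exp_log hx0).symm, ?_⟩
    have h1 : v (x * (t ^ WithZero.log (v x))⁻¹) = 1 := by
      rw [map_mul, map_inv₀, map_zpow₀, ht, ← WithZero.exp_zsmul, smul_eq_mul, mul_one,
        WithZero.exp_log hx0, mul_inv_cancel₀ hx0]
    have h2 : w (x * (t ^ WithZero.log (v x))⁻¹) = 1 :=
      (Valuation.isEquiv_iff_val_eq_one.1 h).1 h1
    rw [map_mul, map_inv₀, map_zpow₀] at h2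
    have h3 : w t ^ WithZero.log (v x) ≠ 0 := zpow_ne_zero _ ((w.ne_zero_iff).2 ht0)
    exact (mul_inv_eq_one₀ h3).1 h2
  have hwt : w t = WithZero.exp 1 := by
    have hs0 : s ≠ 0 := by rintro rfl; exact WithZero.exp_ne_zero (hs.symm.trans (map_zero w))
    obtain ⟨n, -, hn⟩ := eq_zpow s hs0
    have ht1 : 1 < w t := by
      rw [← not_le, ← w.map_one, ← h t 1, ht, v.map_one, ← WithZero.exp_zero,
        WithZero.exp_le_exp]
      omega
    have hwt0 : w t ≠ 0 := (w.ne_zero_iff).2 ht0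
    rw [← WithZero.exp_log hwt0] at hn ht1 ⊢
    rw [hs, ← WithZero.exp_zsmul, WithZero.exp_inj, smul_eq_mul] at hn
    rw [← WithZero.exp_zero, WithZero.exp_lt_exp] at ht1
    rw [Int.eq_one_of_mul_eq_one_left ht1.le hn.symm]
  ext x
  by_cases hx : x = 0
  · simp [hx]
  · obtain ⟨n, h1, h2⟩ := eq_zpow x hx
    rw [h1, h2, hwt, ← WithZero.exp_zsmul, smul_eq_mul, mul_one]

end Valuation

/-! ### Residue fields of a Dedekind domain and of its localizations -/

section InertiaDegree

variable {R L S : Type*} [CommRing R] [Field L] [Algebra R L] [CommRing S] [IsDedekindDomain S]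
  [Algebra R S] [Algebra S L] [IsScalarTower R S L] [IsFractionRing S L]

/-- Every element of `W` is congruent to one of `S` modulo the maximal ideal, so `S` at `P` and `W`
have the same residue field; multiplicativity in towers concludes. -/
theorem inertiaDeg_maximalIdeal_eq (W : ValuationSubring L) [IsDiscreteValuationRing W]
    [Algebra R W] [IsScalarTower R W L] (P : HeightOneSpectrum S)
    (hP : P.valuation L = (IsDiscreteValuationRing.maximalIdeal W).valuation L) :
    (IsLocalRing.maximalIdeal W).inertiaDeg R = P.asIdeal.inertiaDeg R := by
  have hSW : ∀ s : S, algebraMap S L s ∈ W := fun s => by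
    rw [← valuation_le_one_iff, ← hP]
    exact P.valuation_le_one s
  let : Algebra S W := ((algebraMap S L).codRestrict W.toSubring hSW).toAlgebra
  have : IsScalarTower S W L := IsScalarTower.of_algebraMap_eq fun _ => rfl
  have : IsScalarTower R S W := IsScalarTower.of_algebraMap_eq fun a => Subtype.ext <|
    (IsScalarTower.algebraMap_apply R W L a).symm.trans (IsScalarTower.algebraMap_apply R S L a)
  have hmem : ∀ x : W, x ∈ IsLocalRing.maximalIdeal W ↔ P.valuation L (x : L) < 1 := fun x => by
    rw [hP]
    exact ((IsDiscreteValuationRing.maximalIdeal W).valuation_lt_one_iff_mem (K := L) x).symm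
  have hover : (IsLocalRing.maximalIdeal W).LiesOver P.asIdeal := ⟨by
    ext s
    rw [← P.valuation_lt_one_iff_mem (K := L), Ideal.under_def, Ideal.mem_comap, hmem]
    rfl⟩
  have := P.isMaximal
  have hone : (IsLocalRing.maximalIdeal W).inertiaDeg S = 1 := by
    rw [Ideal.inertiaDeg_eq_of_isMaximal P.asIdeal (IsLocalRing.maximalIdeal W)]
    let : Field (S ⧸ P.asIdeal) := Ideal.Quotient.field _
    have hsurj : Function.Surjective
        (Algebra.linearMap (S ⧸ P.asIdeal) (W ⧸ IsLocalRing.maximalIdeal W)) := by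
      intro y
      obtain ⟨x, rfl⟩ := Ideal.Quotient.mk_surjective y
      have hx : P.valuation L (x : L) ≤ 1 := by
        rw [hP, valuation_le_one_iff]
        exact x.2
      obtain ⟨a, ha⟩ := P.exists_valuation_sub_lt_of_integer hx 1
      refine ⟨Ideal.Quotient.mk _ a, ?_⟩
      rw [Algebra.linearMap_apply, Ideal.Quotient.algebraMap_mk_of_liesOver,
        Ideal.Quotient.mk_eq_mk_iff_sub_mem, hmem]
      exact ha
    have hinj : Function.Injective
        (Algebra.linearMap (S ⧸ P.asIdeal) (W ⧸ IsLocalRing.maximalIdeal W)) :=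
      (algebraMap (S ⧸ P.asIdeal) (W ⧸ IsLocalRing.maximalIdeal W)).injective
    rw [← (LinearEquiv.ofBijective _ ⟨hinj, hsurj⟩).finrank_eq, Module.finrank_self]
  rw [Ideal.inertiaDeg_tower P.asIdeal (IsLocalRing.maximalIdeal W), hone, mul_one]

end InertiaDegree

variable {R K L S : Type*} [CommRing R] [IsDomain R] [IsDiscreteValuationRing R] [Field K]
  [Algebra R K] [IsFractionRing R K] [Field L] [Algebra K L] [Algebra R L] [IsScalarTower R K L]
  [CommRing S] [IsDedekindDomain S] [Algebra R S] [Algebra S L] [IsScalarTower R S L]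
  [IsFractionRing S L] [IsIntegralClosure S R L]

variable (S) in
/-- A discrete valuation ring of `L` above `R` is the localization at a prime of the integral
closure of `R`. -/
theorem exists_heightOneSpectrum (W : ValuationSubring L) [IsDiscreteValuationRing W]
    (hW : ∀ a : K, algebraMap K L a ∈ W ↔ a ∈ Set.range (algebraMap R K)) :
    ∃ P : HeightOneSpectrum S, P.asIdeal.LiesOver (IsLocalRing.maximalIdeal R) ∧
      P.valuation L = (IsDiscreteValuationRing.maximalIdeal W).valuation L := by
  have hRW : ∀ a : R, algebraMap R L a ∈ W := fun a => by
    rw [IsScalarTower.algebraMap_apply R K L, hW]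
    exact ⟨a, rfl⟩
  have hSW : ∀ s : S, algebraMap S L s ∈ W := by
    intro s
    let i : R →+* W := (algebraMap R L).codRestrict W.toSubring hRW
    have h1 : IsIntegral R (algebraMap S L s) :=
      (IsIntegralClosure.isIntegral_iff (A := S)).2 ⟨s, rfl⟩
    have h2 : IsIntegral W (algebraMap S L s) := by
      obtain ⟨p, hp, hp0⟩ := h1
      refine ⟨p.map i, hp.map i, ?_⟩
      rw [Polynomial.eval₂_map]
      exact hp0
    obtain ⟨y, hy⟩ := IsIntegrallyClosed.isIntegral_iff.1 h2
    rw [← hy]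
    exact y.2
  let j : S →+* W := (algebraMap S L).codRestrict W.toSubring hSW
  have hm : ∀ s : S, s ∈ (IsLocalRing.maximalIdeal W).comap j ↔
      (IsDiscreteValuationRing.maximalIdeal W).valuation L (algebraMap S L s) < 1 := fun s => by
    rw [Ideal.mem_comap]
    exact ((IsDiscreteValuationRing.maximalIdeal W).valuation_lt_one_iff_mem
      (K := L) (j s)).symm
  -- By maximality one inclusion suffices. A nonzero nonunit of `R` of valuation 1 would have its
  -- inverse in `W` and in `K`, hence in `R` by `hW`.
  have hover : (IsLocalRing.maximalIdeal R) =
      ((IsLocalRing.maximalIdeal W).comap j).comap (algebraMap R S) := by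
    refine (IsLocalRing.maximalIdeal.isMaximal R).eq_of_le
      ((Ideal.IsPrime.comap _).comap _).ne_top fun a ha => ?_
    rw [Ideal.mem_comap, hm, ← IsScalarTower.algebraMap_apply]
    refine lt_of_le_of_ne ((valuation_le_one_iff W _).2 (hRW a)) fun h1 => ?_
    by_cases ha0 : a = 0
    · simp [ha0] at h1
    have h2 : (IsDiscreteValuationRing.maximalIdeal W).valuation L
        (algebraMap K L (algebraMap R K a)⁻¹) ≤ 1 := by
      rw [map_inv₀, ← IsScalarTower.algebraMap_apply, map_inv₀, h1, inv_one]
    rw [valuation_le_one_iff, hW] at h2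
    obtain ⟨b, hb⟩ := h2
    have ha0' : algebraMap R K a ≠ 0 :=
      (map_ne_zero_iff _ (IsFractionRing.injective R K)).2 ha0
    have h3 : b * a = 1 := by
      apply IsFractionRing.injective R K
      rw [map_mul, hb, map_one, inv_mul_cancel₀ ha0']
    exact (IsLocalRing.mem_maximalIdeal _).1 ha (IsUnit.of_mul_eq_one b (by rwa [mul_comm]))
  let P : HeightOneSpectrum S :=
    { asIdeal := (IsLocalRing.maximalIdeal W).comap j
      isPrime := Ideal.IsPrime.comap _
      ne_bot := by
        intro h
        rw [h] at hover
        apply IsDiscreteValuationRing.not_a_field R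
        rw [hover, eq_bot_iff]
        intro a ha
        have hinj : Function.Injective (algebraMap R S) := by
          have h4 : Function.Injective (algebraMap R L) := by
            rw [IsScalarTower.algebraMap_eq R K L]
            exact (algebraMap K L).injective.comp (IsFractionRing.injective R K)
          rw [IsScalarTower.algebraMap_eq R S L] at h4
          exact Function.Injective.of_comp h4
        exact hinj ((Ideal.mem_bot.1 (Ideal.mem_comap.1 ha)).trans (map_zero _).symm) }
  -- The localization of `S` at the center of `W` is a discrete valuation ring contained in `W`. It
  -- has no proper overring other than `L`, so it equals `W`.
  have hle : P.valuationSubringAtPrime L ≤ W := by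
    rintro x ⟨a, s, hs, rfl⟩
    refine mul_mem (hSW a) ?_
    rw [← valuation_le_one_iff, map_inv₀]
    have h1 : ¬ (IsDiscreteValuationRing.maximalIdeal W).valuation L (algebraMap S L s) < 1 :=
      fun h => hs ((hm s).2 h)
    exact inv_le_one_of_one_le₀ (not_lt.1 h1)
  have heq := ValuationSubring.eq_of_le_of_ne_top _ hle (ne_top_of_isDiscreteValuationRing W)
  refine ⟨P, ⟨hover⟩, valuation_eq_of_isEquiv (P.valuation_surjective L)
    (HeightOneSpectrum.valuation_surjective L _) ?_⟩
  rw [Valuation.isEquiv_iff_valuationSubring,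
    ← HeightOneSpectrum.valuationSubringAtPrime_eq_valuationSubring, heq]
  ext x
  exact (valuation_le_one_iff W x).symm

omit [Field K] [Algebra R K] [IsFractionRing R K] [Algebra K L] [IsScalarTower R K L]
  [IsIntegralClosure S R L] in
theorem neg_log_valuation_le_ramificationIdx (P : HeightOneSpectrum S)
    [P.asIdeal.LiesOver (IsLocalRing.maximalIdeal R)]
    (hinj : Function.Injective (algebraMap R S)) {π : R}
    (hπ : Irreducible π) :
    -WithZero.log (P.valuation L (algebraMap R L π)) ≤ P.asIdeal.ramificationIdx R := by
  have hne : (IsLocalRing.maximalIdeal R).map (algebraMap R S) ≠ ⊥ := by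
    rw [Ne, Ideal.map_eq_bot_iff_of_injective hinj]
    exact IsDiscreteValuationRing.not_a_field R
  have hπ0 : algebraMap R S π ≠ 0 := (map_ne_zero_iff _ hinj).2 hπ.ne_zero
  have hmap : (IsLocalRing.maximalIdeal R).map (algebraMap R S) =
      Ideal.span {algebraMap R S π} := by
    rw [hπ.maximalIdeal_eq, Ideal.map_span, Set.image_singleton]
  rw [Ideal.IsDedekindDomain.ramificationIdx_eq_multiplicity (IsLocalRing.maximalIdeal R) _ hne,
    hmap, IsScalarTower.algebraMap_apply R S L, HeightOneSpectrum.valuation_of_algebraMap,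
    HeightOneSpectrum.intValuation_eq_exp_neg_multiplicity _ hπ0, WithZero.log_exp, neg_neg]

variable [FiniteDimensional K L] [Algebra.IsSeparable K L]

variable (R K L) in
/-- The fundamental inequality `∑ e f ≤ [L : K]`, together with the finiteness of the set of
valuation rings above `R`. The valuation rings are indexed by `ι`, and `f i` is the inertia
degree of `W i`, for any `R`-algebra structure compatible with that of `L`. -/
theorem finite_and_sum_le_finrank {ι : Type*} (W : ι → ValuationSubring L)
    (hinj : Function.Injective W) (hdvr : ∀ i, IsDiscreteValuationRing (W i))
    (hW : ∀ i, ∀ a : K, algebraMap K L a ∈ W i ↔ a ∈ Set.range (algebraMap R K))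
    (f : ι → ℕ)
    (hf : ∀ i, ∃ (_ : Algebra R (W i)) (_ : IsScalarTower R (W i) L),
      f i = (IsLocalRing.maximalIdeal (W i)).inertiaDeg R) {π : R} (hπ : Irreducible π) :
    Finite ι ∧ ∀ s : Finset ι, ∑ i ∈ s, (f i : ℤ) *
      -WithZero.log ((IsDiscreteValuationRing.maximalIdeal (W i)).valuation L
        (algebraMap R L π)) ≤ Module.finrank K L := by
  classical
  let S := integralClosure R L
  have hRL : Function.Injective (algebraMap R L) := by
    rw [IsScalarTower.algebraMap_eq R K L]
    exact (algebraMap K L).injective.comp (IsFractionRing.injective R K)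
  have hRS : Function.Injective (algebraMap R S) := by
    rw [IsScalarTower.algebraMap_eq R S L, RingHom.coe_comp] at hRL
    exact hRL.of_comp
  have : IsDedekindDomain S := integralClosure.isDedekindDomain R K L
  have : IsFractionRing S L := integralClosure.isFractionRing_of_finite_extension K L
  have : IsNoetherian R S := IsIntegralClosure.isNoetherian R K L S
  have : Module.IsTorsionFree R L := by
    rw [Module.isTorsionFree_iff_algebraMap_injective]
    exact hRL
  have : Module.Free R S := IsIntegralClosure.module_free R K L S
  have hrank : Module.finrank R S = Module.finrank K L := IsIntegralClosure.rank R K L S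
  choose P hover hP using fun i => exists_heightOneSpectrum S (W i) (hW i)
  let m := IsLocalRing.maximalIdeal R
  let Q : ι → m.primesOver S := fun i => ⟨(P i).asIdeal, (P i).isPrime, hover i⟩
  -- The prime determines the valuation and hence the ring, so the given places form part of the
  -- primes of `S` over `m`, for which `∑ e f` is exactly the rank.
  have hQinj : Function.Injective Q := by
    intro i j hij
    have h1 : P i = P j := HeightOneSpectrum.ext (congrArg Subtype.val hij)
    refine hinj ?_
    ext x
    rw [← valuation_le_one_iff, ← valuation_le_one_iff, ← hP i, ← hP j, h1]
  have hfin : Finite (m.primesOver S) :=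
    (IsDedekindDomain.primesOver_finite m S).to_subtype
  refine ⟨Finite.of_injective Q hQinj, fun s => ?_⟩
  have := Fintype.ofFinite (m.primesOver S)
  rw [← hrank, ← Ideal.sum_ramification_inertia_eq_finrank m S]
  push_cast
  calc _ ≤ ∑ i ∈ s, ((Q i).1.ramificationIdx R : ℤ) * ((Q i).1.inertiaDeg R : ℤ) := by
        refine Finset.sum_le_sum fun i _ => ?_
        obtain ⟨h1, h2, h3⟩ := hf i
        rw [h3, inertiaDeg_maximalIdeal_eq (W i) (P i) (hP i), ← hP i, mul_comm]
        have := hover i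
        exact mul_le_mul_of_nonneg_right (neg_log_valuation_le_ramificationIdx (P i) hRS hπ)
          (Int.natCast_nonneg _)
    _ = ∑ q ∈ s.image Q, (q.1.ramificationIdx R : ℤ) * (q.1.inertiaDeg R : ℤ) :=
        (Finset.sum_image (g := Q)
          (f := fun q => (q.1.ramificationIdx R : ℤ) * (q.1.inertiaDeg R : ℤ))
          fun i _ j _ h => hQinj h).symm
    _ ≤ _ := Finset.sum_le_sum_of_subset_of_nonneg (Finset.subset_univ _) fun q _ _ =>
        mul_nonneg (Int.natCast_nonneg _) (Int.natCast_nonneg _)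

end ValuationExtension

/-! ### Prime divisors of a normal projective variety -/

namespace PlaneDynamics

open CategoryTheory

instance finiteType_gradeZero (k : Type u) [Field k] (N : ℕ) :
    Algebra.FiniteType (homogeneousSubmodule (Fin (N + 1)) k 0) (MvPolynomial (Fin (N + 1)) k) :=
  have : IsScalarTower k (homogeneousSubmodule (Fin (N + 1)) k 0) (MvPolynomial (Fin (N + 1)) k) :=
    ⟨fun a b c => Algebra.smul_mul_assoc a (b : MvPolynomial (Fin (N + 1)) k) c⟩
  Algebra.FiniteType.of_restrictScalars_finiteType k _ _

theorem isNoetherian_projSpace (k : Type u) [Field k] (N : ℕ) : IsNoetherian (ProjSpace k N) := by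
  have : IsNoetherianRing (homogeneousSubmodule (Fin (N + 1)) k 0) :=
    GradedRing.GradeZero.isNoetherianRing _
  have : IsLocallyNoetherian (ProjSpace k N) :=
    LocallyOfFiniteType.isLocallyNoetherian
      (Proj.toSpecZero (homogeneousSubmodule (Fin (N + 1)) k))
  have : CompactSpace (ProjSpace k N) :=
    QuasiCompact.compactSpace_of_compactSpace
      (Proj.toSpecZero (homogeneousSubmodule (Fin (N + 1)) k))
  exact {}

theorem isNoetherian_of_isClosedImmersion {k : Type u} [Field k] {N : ℕ} {B : Scheme.{u}}
    (ι : B ⟶ ProjSpace k N) [IsClosedImmersion ι] : IsNoetherian B := by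
  have := isNoetherian_projSpace k N
  have : IsLocallyNoetherian B := LocallyOfFiniteType.isLocallyNoetherian ι
  have : CompactSpace B := QuasiCompact.compactSpace_of_compactSpace ι
  exact {}

/-- The structure morphism to `k` is recovered from `ι` followed by the map from projective space to
the spectrum of the degree-zero part, and embeds `k` in the function field. -/
theorem charZero_functionField {k : Type u} [Field k] [CharZero k] {N : ℕ} {B : Scheme.{u}}
    [IsIntegral B] (ι : B ⟶ ProjSpace k N) : CharZero B.functionField := by
  have : Nonempty (⊤ : B.Opens) := ⟨⟨genericPoint B, trivial⟩⟩
  let i : k →+* B.functionField :=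
    (B.germToFunctionField ⊤).hom.comp ((ι ≫ Proj.toSpecZero
      (homogeneousSubmodule (Fin (N + 1)) k)).appTop.hom.comp
      ((Scheme.ΓSpecIso (.of (homogeneousSubmodule (Fin (N + 1)) k 0))).inv.hom.comp
        (algebraMap k (homogeneousSubmodule (Fin (N + 1)) k 0))))
  exact charZero_of_injective_ringHom i.injective

theorem isDiscreteValuationRing_stalk {B : Scheme.{u}} [IsIntegral B] [IsLocallyNoetherian B]
    (hB : IsNormalScheme B) {x : B} (hx : ringKrullDim (B.presheaf.stalk x) = 1) :
    IsDiscreteValuationRing (B.presheaf.stalk x) := by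
  have hfield : ¬ IsField (B.presheaf.stalk x) := fun h => by
    rw [ringKrullDim_eq_zero_of_isField h] at hx
    exact zero_ne_one hx
  have := (hB x).2
  have hdim : Ring.DimensionLEOne (B.presheaf.stalk x) := by
    refine ⟨fun {q} hq0 hq => ?_⟩
    rcases (IsLocalRing.le_maximalIdeal hq.ne_top).eq_or_lt with h | h
    · exact h ▸ IsLocalRing.maximalIdeal.isMaximal _
    · have h1 := Ideal.height_strict_mono_of_isPrime_of_isPrime h
      rw [← IsLocalRing.maximalIdeal_height_eq_ringKrullDim] at hx
      rw [show (IsLocalRing.maximalIdeal (B.presheaf.stalk x)).height = 1 by exact_mod_cast hx,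
        Order.lt_one_iff] at h1
      exact absurd (Ideal.height_eq_zero_iff_eq_bot.1 h1) hq0
  have : IsDedekindDomain (B.presheaf.stalk x) := {}
  exact ((IsDiscreteValuationRing.TFAE _ hfield).out 2 0).1 this

/-- A rational function is regular at all but finitely many points of codimension one. -/
theorem finite_setOf_notMem_range_stalk {B : Scheme.{u}} [IsIntegral B] [IsNoetherian B]
    (a : B.functionField) :
    {x : B | ringKrullDim (B.presheaf.stalk x) = 1 ∧
      a ∉ Set.range (algebraMap (B.presheaf.stalk x) B.functionField)}.Finite := by
  suffices h : ∀ U : B.affineOpens, {x : B | x ∈ U.1 ∧ ringKrullDim (B.presheaf.stalk x) = 1 ∧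
      a ∉ Set.range (algebraMap (B.presheaf.stalk x) B.functionField)}.Finite by
    obtain ⟨s, hs⟩ := (isCompact_univ (X := B)).elim_finite_subcover
      (fun U : B.affineOpens => (U.1 : Set B)) (fun U => U.1.isOpen) fun x _ => by
        have hx : x ∈ (⨆ U : B.affineOpens, (U : B.Opens)) := by
          rw [iSup_affineOpens_eq_top]
          trivial
        simpa using hx
    refine (s.finite_toSet.biUnion fun U _ => h U).subset fun x hx => ?_
    obtain ⟨U, hU, hxU⟩ := Set.mem_iUnion₂.1 (hs (Set.mem_univ x))
    exact Set.mem_biUnion hU ⟨hxU, hx⟩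
  rintro ⟨U, hU⟩
  by_cases hne : Nonempty U
  swap
  · refine Set.Finite.subset Set.finite_empty fun x hx => hne ⟨⟨x, hx.1⟩⟩
  have := functionField_isFractionRing_of_isAffineOpen B U hU
  have : IsNoetherianRing Γ(B, U) := IsLocallyNoetherian.component_noetherian ⟨U, hU⟩
  -- A codimension-one point where `a = n / m` is not regular is a height-one prime containing `m`.
  -- It is therefore minimal over `(m)`, and there are finitely many such primes.
  obtain ⟨n, m, hm, hnm⟩ := IsFractionRing.div_surjective Γ(B, U) a
  have hfin := (Ideal.span {m}).finite_minimalPrimes_of_isNoetherianRing Γ(B, U)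
  let e : PrimeSpectrum Γ(B, U) → B := hU.fromSpec
  have hinj : Function.Injective (PrimeSpectrum.asIdeal (R := Γ(B, U))) :=
    fun _ _ => PrimeSpectrum.ext
  refine ((hfin.preimage hinj.injOn).image e).subset ?_
  rintro x ⟨hxU, hx, ha⟩
  refine ⟨hU.primeIdealOf ⟨x, hxU⟩, ?_, hU.fromSpec_primeIdealOf ⟨x, hxU⟩⟩
  let := TopCat.Presheaf.algebra_section_stalk B.presheaf (⟨x, hxU⟩ : U)
  have hloc := hU.isLocalization_stalk ⟨x, hxU⟩
  set p := hU.primeIdealOf ⟨x, hxU⟩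
  have htower := functionField_isScalarTower B U ⟨x, hxU⟩
  have hheight : p.asIdeal.height = 1 := by
    have := IsLocalization.AtPrime.ringKrullDim_eq_height p.asIdeal (B.presheaf.stalk x)
    rw [hx] at this
    exact_mod_cast this.symm
  have hmem : m ∈ p.asIdeal := by
    by_contra hmem
    have hunit : IsUnit (algebraMap Γ(B, U) (B.presheaf.stalk x) m) :=
      IsLocalization.map_units _ (⟨m, hmem⟩ : p.asIdeal.primeCompl)
    obtain ⟨c, hc⟩ := hunit.exists_right_inv
    have hm0 : algebraMap Γ(B, U) B.functionField m ≠ 0 :=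
      IsFractionRing.to_map_ne_zero_of_mem_nonZeroDivisors hm
    refine ha ⟨algebraMap Γ(B, U) (B.presheaf.stalk x) n * c, ?_⟩
    have h1 := congrArg (algebraMap (B.presheaf.stalk x) B.functionField) hc
    rw [map_mul, map_one, ← htower.algebraMap_apply] at h1
    rw [← hnm, map_mul, ← htower.algebraMap_apply, eq_div_iff hm0]
    linear_combination algebraMap Γ(B, U) B.functionField n * h1
  refine Ideal.mem_minimalPrimes_of_height_le ((Ideal.span_singleton_le_iff_mem _).2 hmem) ?_
  rw [hheight]
  exact Ideal.one_le_height_span_singleton_of_mem_nonZeroDivisors hm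

end PlaneDynamics

noncomputable section

/-! ### Places over prime divisors -/

namespace PlaneDynamics

open NonarchimedeanEstimates ValuationExtension

/-- A Hilbert polynomial is nonnegative at large integers, so its leading coefficient cannot be
negative. This lets local inequalities be summed with degree weights. -/
theorem pointDegree_nonneg {k : Type u} [Field k] {N : ℕ} (P : ProjSpace k N) :
    0 ≤ pointDegree P := by
  rw [pointDegree]
  split_ifs with h
  swap
  · rfl
  refine mul_nonneg (Nat.cast_nonneg _) ?_
  have hQ := h.choose_spec
  set Q := h.choose
  by_contra! hneg
  rcases lt_or_ge 0 Q.degree with hdeg | hdeg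
  · have h1 := (Polynomial.tendsto_atBot_of_leadingCoeff_nonpos Q hdeg hneg.le).comp
      (tendsto_natCast_atTop_atTop (R := ℚ))
    obtain ⟨n, hn, hn'⟩ := (hQ.and (h1.eventually_lt_atBot 0)).exists
    simp only [Function.comp_apply, hn] at hn'
    exact absurd hn' (not_lt.2 (Nat.cast_nonneg _))
  · obtain ⟨n, hn⟩ := hQ.exists
    rw [Polynomial.eq_C_of_degree_le_zero hdeg] at hn hneg
    rw [Polynomial.leadingCoeff_C] at hneg
    rw [Polynomial.eval_C] at hn
    rw [hn] at hneg
    exact absurd hneg (not_lt.2 (Nat.cast_nonneg _))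

variable {B : Scheme.{u}} [IsIntegral B] {L : Type v} [Field L] [Algebra B.functionField L]

namespace DivisorPlace

theorem ext_of_point_eq {w w' : DivisorPlace B L} (h : w.point = w'.point)
    (h' : w.ring = w'.ring) : w = w' := by
  cases w
  cases w'
  subst h
  subst h'
  rfl

theorem valuation_le_one_iff (w : DivisorPlace B L) (a : L) : w.valuation a ≤ 1 ↔ a ∈ w.ring :=
  ValuationExtension.valuation_le_one_iff w.ring a

theorem valuation_algebraMap_le_one_iff (w : DivisorPlace B L) (a : B.functionField) :
    w.valuation (algebraMap B.functionField L a) ≤ 1 ↔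
      a ∈ Set.range (algebraMap (B.presheaf.stalk w.point) B.functionField) := by
  rw [valuation_le_one_iff, w.lies_over]

/-- A valuation ring is integrally closed. Hence poles of `a` lie only over poles of the
coefficients of its minimal polynomial, which reduces finiteness over `L` to finiteness on `B`. -/
theorem mem_ring_of_coeff_minpoly_mem (w : DivisorPlace B L) {a : L}
    (ha : IsIntegral B.functionField a)
    (h : ∀ n, (minpoly B.functionField a).coeff n ∈
      Set.range (algebraMap (B.presheaf.stalk w.point) B.functionField)) : a ∈ w.ring := by
  have hcoeff : (↑((minpoly B.functionField a).map (algebraMap B.functionField L)).coeffs : Set L) ⊆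
      w.ring.toSubring := by
    intro c hc
    obtain ⟨n, -, rfl⟩ := Polynomial.mem_coeffs_iff.1 hc
    rw [Polynomial.coeff_map]
    exact (w.lies_over _).2 (h n)
  have hint : IsIntegral w.ring a := by
    refine ⟨((minpoly B.functionField a).map (algebraMap B.functionField L)).toSubring
      w.ring.toSubring hcoeff, ?_, ?_⟩
    · exact (Polynomial.monic_toSubring _ _ _).2 ((minpoly.monic ha).map _)
    · change Polynomial.eval₂ w.ring.toSubring.subtype a _ = 0
      rw [← Polynomial.eval_map, Polynomial.map_toSubring, Polynomial.eval_map]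
      exact minpoly.aeval _ _
  obtain ⟨y, hy⟩ := IsIntegrallyClosed.isIntegral_iff.1 hint
  rw [← hy]
  exact y.2

/-- The fundamental inequality for the places above a prime divisor. -/
theorem finite_and_sum_le_finrank [CharZero B.functionField] [FiniteDimensional B.functionField L]
    {x : B} [IsDiscreteValuationRing (B.presheaf.stalk x)] {π : B.presheaf.stalk x}
    (hπ : Irreducible π) :
    Finite {w : DivisorPlace B L // w.point = x} ∧
      ∀ s : Finset {w : DivisorPlace B L // w.point = x},
        ∑ w ∈ s, (w.1.residueDegree : ℤ) * -WithZero.log (w.1.valuation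
          (algebraMap B.functionField L (algebraMap (B.presheaf.stalk x) B.functionField π))) ≤
        Module.finrank B.functionField L := by
  let : Algebra (B.presheaf.stalk x) L := ((algebraMap B.functionField L).comp
    (algebraMap (B.presheaf.stalk x) B.functionField)).toAlgebra
  have : IsScalarTower (B.presheaf.stalk x) B.functionField L :=
    IsScalarTower.of_algebraMap_eq fun _ => rfl
  refine ValuationExtension.finite_and_sum_le_finrank (B.presheaf.stalk x) B.functionField L
    (ι := {w : DivisorPlace B L // w.point = x}) (fun w => w.1.ring)
    (fun w w' h => Subtype.ext (ext_of_point_eq (w.2.trans w'.2.symm) h)) (fun w => w.1.isDVR)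
    ?_ (fun w => w.1.residueDegree) ?_ hπ
  · rintro ⟨w, rfl⟩
    exact w.lies_over
  · rintro ⟨w, rfl⟩
    exact ⟨inferInstance, IsScalarTower.of_algebraMap_eq fun _ => rfl, rfl⟩

variable [IsNoetherian B]

theorem finite_setOf_point_eq [CharZero B.functionField] [FiniteDimensional B.functionField L]
    (hB : IsNormalScheme B) (x : B) : {w : DivisorPlace B L | w.point = x}.Finite := by
  by_cases hx : ringKrullDim (B.presheaf.stalk x) = 1
  · have := isDiscreteValuationRing_stalk hB hx
    obtain ⟨π, hπ⟩ := IsDiscreteValuationRing.exists_irreducible (B.presheaf.stalk x)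
    exact (finite_and_sum_le_finrank hπ).1
  · refine Set.finite_empty.subset fun w hw => hx ?_
    obtain rfl : w.point = x := hw
    exact w.codim_one

theorem finite_setOf_notMem_ring [CharZero B.functionField] [FiniteDimensional B.functionField L]
    (hB : IsNormalScheme B) (a : L) : {w : DivisorPlace B L | a ∉ w.ring}.Finite := by
  have ha : IsIntegral B.functionField a := IsIntegral.of_finite _ _
  have hfin : (⋃ c ∈ (minpoly B.functionField a).coeffs,
      {x : B | ringKrullDim (B.presheaf.stalk x) = 1 ∧
        c ∉ Set.range (algebraMap (B.presheaf.stalk x) B.functionField)}).Finite :=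
    (Finset.finite_toSet _).biUnion fun c _ => finite_setOf_notMem_range_stalk c
  refine (hfin.biUnion fun x _ => finite_setOf_point_eq (L := L) hB x).subset fun w hw => ?_
  refine Set.mem_biUnion ?_ (rfl : w.point = w.point)
  by_contra hmem
  refine hw (w.mem_ring_of_coeff_minpoly_mem ha fun n => ?_)
  by_contra hn
  refine hmem (Set.mem_biUnion (Polynomial.coeff_mem_coeffs fun h0 => hn ?_) ⟨w.codim_one, hn⟩)
  rw [h0]
  exact ⟨0, map_zero _⟩

end DivisorPlace

/-- Bounds for the orders of the poles of the elements of `T` along prime divisors: at the point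
`x` of codimension one they are at most `exponent x`. -/
structure DenominatorBound (B : Scheme.{u}) [IsIntegral B] (T : Set B.functionField) where
  /-- a uniformizer at each point of codimension one -/
  uniformizer : ∀ x : B, B.presheaf.stalk x
  /-- a bound for the orders of the poles -/
  exponent : B → ℕ
  irreducible : ∀ x, ringKrullDim (B.presheaf.stalk x) = 1 → Irreducible (uniformizer x)
  mem_range : ∀ x, ringKrullDim (B.presheaf.stalk x) = 1 → ∀ t ∈ T,
    algebraMap (B.presheaf.stalk x) B.functionField (uniformizer x) ^ exponent x * t ∈
      Set.range (algebraMap (B.presheaf.stalk x) B.functionField)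
  finite : {x | ringKrullDim (B.presheaf.stalk x) = 1 ∧ exponent x ≠ 0}.Finite

/-- A common denominator is a unit times a power of `π`. The last clause, that the exponent is 0
unless a pole is present, is what later makes the support of the bound finite. -/
theorem exists_uniformizer_pow_mul_mem_range {R K : Type*} [CommRing R] [IsDomain R]
    [IsDiscreteValuationRing R] [Field K] [Algebra R K] [IsFractionRing R K] {T : Set K}
    (hT : T.Finite) : ∃ (π : R) (n : ℕ), Irreducible π ∧
      (∀ t ∈ T, algebraMap R K π ^ n * t ∈ Set.range (algebraMap R K)) ∧
      (n ≠ 0 → ∃ t ∈ T, t ∉ Set.range (algebraMap R K)) := by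
  obtain ⟨π, hπ⟩ := IsDiscreteValuationRing.exists_irreducible R
  by_cases h : ∀ t ∈ T, t ∈ Set.range (algebraMap R K)
  · exact ⟨π, 0, hπ, by simpa using h, by simp⟩
  obtain ⟨b, hb⟩ := IsLocalization.exist_integer_multiples_of_finite (nonZeroDivisors R)
    (S := K) (ι := hT.toFinset) fun t => t.1
  obtain ⟨n, c, hc⟩ := IsDiscreteValuationRing.eq_unit_mul_pow_irreducible
    (nonZeroDivisors.ne_zero b.2) hπ
  refine ⟨π, n, hπ, fun t ht => ?_, fun _ => by push Not at h; exact h⟩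
  obtain ⟨a, ha⟩ := hb ⟨t, hT.mem_toFinset.2 ht⟩
  refine ⟨↑c⁻¹ * a, ?_⟩
  rw [map_mul, ha, Algebra.smul_def, hc, ← mul_assoc, ← map_mul, Units.inv_mul_cancel_left, map_pow]

theorem nonempty_denominatorBound [IsNoetherian B] (hB : IsNormalScheme B)
    {T : Set B.functionField} (hT : T.Finite) : Nonempty (DenominatorBound B T) := by
  have h : ∀ x : B, ∃ (π : B.presheaf.stalk x) (n : ℕ), ringKrullDim (B.presheaf.stalk x) = 1 →
      Irreducible π ∧
      (∀ t ∈ T, algebraMap (B.presheaf.stalk x) B.functionField π ^ n * t ∈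
        Set.range (algebraMap (B.presheaf.stalk x) B.functionField)) ∧
      (n ≠ 0 → ∃ t ∈ T, t ∉ Set.range (algebraMap (B.presheaf.stalk x) B.functionField)) := by
    intro x
    by_cases hx : ringKrullDim (B.presheaf.stalk x) = 1
    · have := isDiscreteValuationRing_stalk hB hx
      obtain ⟨π, n, h⟩ := exists_uniformizer_pow_mul_mem_range (R := B.presheaf.stalk x) hT
      exact ⟨π, n, fun _ => h⟩
    · exact ⟨0, 0, fun h => absurd h hx⟩
  choose π n h using h
  refine ⟨⟨π, n, fun x hx => (h x hx).1, fun x hx => (h x hx).2.1, ?_⟩⟩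
  refine (hT.biUnion fun t _ => finite_setOf_notMem_range_stalk t).subset fun x hx => ?_
  obtain ⟨t, ht, ht'⟩ := (h x hx.1).2.2 hx.2
  exact Set.mem_biUnion ht ⟨hx.1, ht'⟩

/-! ### Local error terms and their sum over all places -/

namespace DenominatorBound

variable {T : Set B.functionField} (D : DenominatorBound B T)

/-- The ramification index of a place, as the order of the uniformizer below it. -/
def ramification (w : DivisorPlace B L) : ℤ :=
  -WithZero.log (w.valuation (algebraMap B.functionField L
    (algebraMap (B.presheaf.stalk w.point) B.functionField (D.uniformizer w.point))))

theorem valuation_uniformizer (w : DivisorPlace B L) :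
    w.valuation (algebraMap B.functionField L
      (algebraMap (B.presheaf.stalk w.point) B.functionField (D.uniformizer w.point))) =
    WithZero.exp (-D.ramification w) := by
  have h0 : algebraMap B.functionField L (algebraMap (B.presheaf.stalk w.point) B.functionField
      (D.uniformizer w.point)) ≠ 0 := by
    rw [map_ne_zero_iff _ (algebraMap B.functionField L).injective,
      map_ne_zero_iff _ (IsFractionRing.injective (B.presheaf.stalk w.point) B.functionField)]
    exact (D.irreducible w.point w.codim_one).ne_zero
  rw [ramification, neg_neg, WithZero.exp_log ((w.valuation.ne_zero_iff).2 h0)]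

theorem ramification_nonneg (w : DivisorPlace B L) : 0 ≤ D.ramification w := by
  have h := (w.valuation_algebraMap_le_one_iff _).2 ⟨D.uniformizer w.point, rfl⟩
  rw [D.valuation_uniformizer w, ← WithZero.exp_zero, WithZero.exp_le_exp] at h
  linarith

theorem valuation_le (w : DivisorPlace B L) {t : B.functionField} (ht : t ∈ T) :
    w.valuation (algebraMap B.functionField L t) ≤
      WithZero.exp (D.exponent w.point * D.ramification w) := by
  have h := (w.valuation_algebraMap_le_one_iff _).2 (D.mem_range w.point w.codim_one t ht)
  rw [map_mul, map_pow, map_mul, map_pow, D.valuation_uniformizer w, ← WithZero.exp_nsmul] at h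
  calc w.valuation (algebraMap B.functionField L t)
      = WithZero.exp (D.exponent w.point * D.ramification w) *
        (WithZero.exp (D.exponent w.point • -D.ramification w) *
          w.valuation (algebraMap B.functionField L t)) := by
        rw [← mul_assoc, ← WithZero.exp_add]
        simp
    _ ≤ _ := mul_le_of_le_one_right' h

theorem one_le_exp (w : DivisorPlace B L) :
    1 ≤ WithZero.exp (D.exponent w.point * D.ramification w) := by
  rw [← WithZero.exp_zero, WithZero.exp_le_exp]
  exact mul_nonneg (Int.natCast_nonneg _) (D.ramification_nonneg w)

/-- The degree of the divisor of poles given by the bound. -/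
def degree {k : Type u} [Field k] {N : ℕ} (ι : B ⟶ ProjSpace k N) : ℝ :=
  ∑ x ∈ D.finite.toFinset, (pointDegree (ι x) : ℝ) * D.exponent x

theorem degree_nonneg {k : Type u} [Field k] {N : ℕ} (ι : B ⟶ ProjSpace k N) :
    0 ≤ D.degree ι :=
  Finset.sum_nonneg fun x _ => mul_nonneg (by exact_mod_cast pointDegree_nonneg (ι x))
    (Nat.cast_nonneg _)

/-- Group the places by the divisor `x` below them: each group contributes the degree of `x` times
its exponent times `∑ e f`, and `∑ e f ≤ [L : K]`. `D.degree ι` does not involve `L`, which is why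
the final constant is independent of the point. -/
theorem sum_le_degree [IsNoetherian B] [CharZero B.functionField]
    [FiniteDimensional B.functionField L] (hB : IsNormalScheme B) {k : Type u} [Field k] {N : ℕ}
    (ι : B ⟶ ProjSpace k N) (s : Finset (DivisorPlace B L)) :
    ∑ w ∈ s, (pointDegree (ι w.point) : ℝ) * w.residueDegree *
      (D.exponent w.point * D.ramification w) ≤
    Module.finrank B.functionField L * D.degree ι := by
  classical
  have hmaps : ∀ w ∈ s.filter (fun w => D.exponent w.point ≠ 0), w.point ∈ D.finite.toFinset := by
    intro w hw
    rw [Set.Finite.mem_toFinset]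
    exact ⟨w.codim_one, (Finset.mem_filter.1 hw).2⟩
  rw [← Finset.sum_filter_of_ne (p := fun w => D.exponent w.point ≠ 0) (by
    rintro w - hne h0
    simp [h0] at hne), ← Finset.sum_fiberwise_of_maps_to hmaps, degree, Finset.mul_sum]
  refine Finset.sum_le_sum fun x hx => ?_
  rw [Set.Finite.mem_toFinset] at hx
  have := isDiscreteValuationRing_stalk hB hx.1
  have h := (DivisorPlace.finite_and_sum_le_finrank (L := L) (D.irreducible x hx.1)).2
    ((s.filter (fun w => D.exponent w.point ≠ 0)).subtype fun w => w.point = x)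
  have h1 : ∑ w ∈ (s.filter (fun w => D.exponent w.point ≠ 0)).filter (fun w => w.point = x),
      (w.residueDegree : ℤ) * D.ramification w ≤ Module.finrank B.functionField L := by
    refine le_trans (le_of_eq ?_) h
    rw [← Finset.subtype_map, Finset.sum_map]
    refine Finset.sum_congr rfl ?_
    rintro ⟨w, rfl⟩ -
    rfl
  have hdeg : (0 : ℝ) ≤ pointDegree (ι x) := by exact_mod_cast pointDegree_nonneg (ι x)
  have h2 : ∑ w ∈ (s.filter (fun w => D.exponent w.point ≠ 0)).filter (fun w => w.point = x),
      (w.residueDegree : ℝ) * D.ramification w ≤ Module.finrank B.functionField L := by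
    exact_mod_cast h1
  calc _ = (pointDegree (ι x) : ℝ) * D.exponent x *
      ∑ w ∈ (s.filter (fun w => D.exponent w.point ≠ 0)).filter (fun w => w.point = x),
        (w.residueDegree : ℝ) * D.ramification w := by
        rw [Finset.mul_sum]
        refine Finset.sum_congr rfl fun w hw => ?_
        rw [(Finset.mem_filter.1 hw).2]
        ring
    _ ≤ (pointDegree (ι x) : ℝ) * D.exponent x * Module.finrank B.functionField L :=
        mul_le_mul_of_nonneg_left h2 (mul_nonneg hdeg (Nat.cast_nonneg _))
    _ = _ := by ring

end DenominatorBound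

end PlaneDynamics

end

noncomputable section

/-! ### Canonical heights -/

namespace PlaneDynamics

open NonarchimedeanEstimates

/-! ### Action on points, fields of definition and integrality of orbits -/

namespace PlaneAut

variable {F : Type u} [Field F] {E : Type v} [Field E] [Algebra F E]

theorem aeval_act (f : PlaneAut F) (z : Fin 2 → E) (p : MvPolynomial (Fin 2) F) :
    aeval (f.act z) p = aeval z (f p) := by
  have h : aeval (f.act z) = (aeval z).comp (f : MvPolynomial (Fin 2) F →ₐ[F] _) := by
    ext i
    simp [PlaneAut.act, PlaneAut.component]
  rw [h]
  rfl

theorem act_symm_act (f : PlaneAut F) (z : Fin 2 → E) :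
    PlaneAut.act f.symm (f.act z) = z := by
  ext i
  rw [PlaneAut.act, aeval_act, PlaneAut.component, AlgEquiv.apply_symm_apply, aeval_X]

theorem act_act_symm (f : PlaneAut F) (z : Fin 2 → E) :
    f.act (PlaneAut.act f.symm z) = z :=
  act_symm_act f.symm z

theorem act_map {E' : Type*} [Field E'] [Algebra F E'] (χ : E →ₐ[F] E') (f : PlaneAut F)
    (z : Fin 2 → E) : f.act (χ ∘ z) = χ ∘ f.act z := by
  ext i
  simp only [PlaneAut.act, Function.comp_apply]
  rw [← AlgHom.comp_apply, comp_aeval]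
  rfl

theorem iterate_act_map {E' : Type*} [Field E'] [Algebra F E'] (χ : E →ₐ[F] E') (f : PlaneAut F)
    (z : Fin 2 → E) (n : ℕ) : f.act^[n] (χ ∘ z) = χ ∘ f.act^[n] z := by
  induction n with
  | zero => rfl
  | succ n ih => rw [Function.iterate_succ_apply', ih, act_map, Function.iterate_succ_apply']

theorem act_mem_adjoin (f : PlaneAut F) (z : Fin 2 → E) (i : Fin 2) :
    f.act z i ∈ IntermediateField.adjoin F (Set.range z) := by
  let z' : Fin 2 → IntermediateField.adjoin F (Set.range z) :=
    fun j => ⟨z j, IntermediateField.subset_adjoin _ _ ⟨j, rfl⟩⟩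
  have h := congrFun (act_map (IntermediateField.adjoin F (Set.range z)).val f z') i
  rw [show (IntermediateField.adjoin F (Set.range z)).val ∘ z' = z from rfl] at h
  rw [h]
  exact (f.act z' i).2

/-- Both `f` and its inverse have coefficients in `F`. Heights along an orbit are thus computed over
one field, and no comparison of heights over different fields is needed. -/
theorem adjoin_act (f : PlaneAut F) (z : Fin 2 → E) :
    IntermediateField.adjoin F (Set.range (f.act z)) =
      IntermediateField.adjoin F (Set.range z) := by
  refine le_antisymm ?_ ?_
  · rw [IntermediateField.adjoin_le_iff]
    rintro _ ⟨i, rfl⟩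
    exact f.act_mem_adjoin z i
  · rw [IntermediateField.adjoin_le_iff]
    rintro _ ⟨i, rfl⟩
    have := PlaneAut.act_mem_adjoin f.symm (f.act z) i
    rwa [act_symm_act] at this

theorem adjoin_iterate_act (f : PlaneAut F) (z : Fin 2 → E) (n : ℕ) :
    IntermediateField.adjoin F (Set.range (f.act^[n] z)) =
      IntermediateField.adjoin F (Set.range z) := by
  induction n with
  | zero => rfl
  | succ n ih => rw [Function.iterate_succ_apply', adjoin_act, ih]

theorem valuation_act_le_one (v : Valuation E ℤᵐ⁰) (f : PlaneAut F)
    (hf : ∀ i m, v (algebraMap F E (coeff m (f.component i))) ≤ 1) {z : Fin 2 → E}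
    (hz : ∀ i, v (z i) ≤ 1) (i : Fin 2) : v (f.act z i) ≤ 1 := by
  have := valuation_aeval_le v (p := f.component i) (n := f.degree)
    (fun m hm => (le_totalDegree hm).trans (f.totalDegree_component_le i)) (hf i) le_rfl hz
  rwa [one_pow, mul_one] at this

theorem valuation_iterate_act_le_one (v : Valuation E ℤᵐ⁰) (f : PlaneAut F)
    (hf : ∀ i m, v (algebraMap F E (coeff m (f.component i))) ≤ 1) {z : Fin 2 → E}
    (hz : ∀ i, v (z i) ≤ 1) (n : ℕ) : ∀ i, v (f.act^[n] z i) ≤ 1 := by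
  induction n with
  | zero => exact hz
  | succ n ih =>
    rw [Function.iterate_succ_apply']
    exact valuation_act_le_one v f hf ih

end PlaneAut

theorem projHeight_eq_heightOver {k : Type u} [Field k] {N : ℕ} {B : Scheme.{u}} [IsIntegral B]
    (ι : B ⟶ ProjSpace k N) {L : IntermediateField B.functionField
      (AlgebraicClosure B.functionField)} {x : Fin 3 → AlgebraicClosure B.functionField}
    {y : Fin 3 → L} (hxy : ∀ i, x i = y i)
    (hL : IntermediateField.adjoin B.functionField (Set.range x) = L) :
    projHeight ι x = heightOver ι L y := by
  subst hL
  rw [projHeight]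
  congr 1
  ext i
  exact hxy i

theorem adjoin_range_affine {F E : Type*} [Field F] [Field E] [Algebra F E] (z : Fin 2 → E) :
    IntermediateField.adjoin F (Set.range ![z 0, z 1, 1]) =
      IntermediateField.adjoin F (Set.range z) := by
  refine le_antisymm ?_ ?_ <;> rw [IntermediateField.adjoin_le_iff]
  · rintro _ ⟨i, rfl⟩
    fin_cases i
    · exact IntermediateField.subset_adjoin _ _ ⟨0, rfl⟩
    · exact IntermediateField.subset_adjoin _ _ ⟨1, rfl⟩
    · exact one_mem _
  · rintro _ ⟨i, rfl⟩
    fin_cases i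
    · exact IntermediateField.subset_adjoin _ _ ⟨0, rfl⟩
    · exact IntermediateField.subset_adjoin _ _ ⟨1, rfl⟩

theorem height_eq_heightOver {k : Type u} [Field k] {N : ℕ} {B : Scheme.{u}} [IsIntegral B]
    (ι : B ⟶ ProjSpace k N) {L : IntermediateField B.functionField
      (AlgebraicClosure B.functionField)} {z : Fin 2 → L}
    (hL : IntermediateField.adjoin B.functionField (Set.range (L.val ∘ z)) = L) :
    height ι (L.val ∘ z) = heightOver ι L ![z 0, z 1, 1] := by
  refine projHeight_eq_heightOver ι (fun i => ?_) ((adjoin_range_affine _).trans hL)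
  fin_cases i <;> rfl

/-- The coefficients of a plane automorphism and of its inverse, together with those of
polynomials `a`. -/
def coefficientSet {F : Type u} [Field F] (f : PlaneAut F)
    (a : Fin 2 → Fin 2 ⊕ Fin 2 → Polynomial F) : Set F :=
  (Set.range fun m : Fin 2 × (Fin 2 →₀ ℕ) => coeff m.2 (f.component m.1)) ∪
  (Set.range fun m : Fin 2 × (Fin 2 →₀ ℕ) => coeff m.2 (PlaneAut.component f.symm m.1)) ∪
  Set.range fun m : Fin 2 × (Fin 2 ⊕ Fin 2) × ℕ => (a m.1 m.2.1).coeff m.2.2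

theorem finite_coefficientSet {F : Type u} [Field F] (f : PlaneAut F)
    (a : Fin 2 → Fin 2 ⊕ Fin 2 → Polynomial F) : (coefficientSet f a).Finite := by
  have h1 : ∀ p : Fin 2 → MvPolynomial (Fin 2) F,
      (Set.range fun m : Fin 2 × (Fin 2 →₀ ℕ) => coeff m.2 (p m.1)).Finite := by
    intro p
    refine ((Set.finite_iUnion fun i => ((p i).support.finite_toSet.image
      fun m => coeff m (p i))).insert 0).subset ?_
    rintro _ ⟨⟨i, m⟩, rfl⟩
    by_cases hm : coeff m (p i) = 0
    · exact .inl hm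
    · exact .inr (Set.mem_iUnion.2 ⟨i, m, mem_support_iff.2 hm, rfl⟩)
  refine ((h1 _).union (h1 _)).union ?_
  refine ((Set.finite_iUnion fun i => Set.finite_iUnion fun j =>
    (a i j).coeffs.finite_toSet).insert 0).subset ?_
  rintro _ ⟨⟨i, j, n⟩, rfl⟩
  by_cases hm : (a i j).coeff n = 0
  · exact .inl hm
  · exact .inr (Set.mem_iUnion₂.2 ⟨i, j, Polynomial.coeff_mem_coeffs hm⟩)

/-! ### Local and global canonical heights over a fixed extension -/

section FixedField

variable {k : Type u} [Field k] {N : ℕ} {B : Scheme.{u}} [IsIntegral B]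
  {L : Type v} [Field L] [Algebra B.functionField L]

theorem heightOver_eq_sum (ι : B ⟶ ProjSpace k N) {s : Finset (DivisorPlace B L)}
    {z : Fin 2 → L} (hs : ∀ w ∉ s, ∀ i, w.valuation (z i) ≤ 1) :
    heightOver ι L ![z 0, z 1, 1] =
      (∑ w ∈ s, (pointDegree (ι w.point) : ℝ) * w.residueDegree *
        (logGauge w.valuation z : ℝ)) / Module.finrank B.functionField L := by
  rw [heightOver, finsum_eq_sum_of_support_subset]
  · rfl
  · intro w hw
    by_contra hws
    refine hw ?_
    have h : w.localHeight ![z 0, z 1, 1] = 0 := logGauge_eq_zero (hs w hws)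
    simp [h]

variable (f : PlaneAut B.functionField) {a : Fin 2 → Fin 2 ⊕ Fin 2 → Polynomial B.functionField}

/-- The abstract expansion theorem applies with `H` the local gauge and `c = 2 d log A`; this
constant also covers the error `log A` in the upper bounds. -/
theorem exists_tendsto_logGauge [CharZero B.functionField]
    (D : DenominatorBound B (coefficientSet f a))
    (hd : 2 ≤ f.degree)
    (ha : ∀ j, ∑ i, a j i * chart B.functionField j (homogeneousComponent f.degree
      (Sum.elim f.component (PlaneAut.component f.symm) i)) = 1)
    (w : DivisorPlace B L) (z : Fin 2 → L) :
    ∃ G G' : ℝ,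
      Tendsto (fun n => (logGauge w.valuation (f.act^[n] z) : ℝ) / (f.degree : ℝ) ^ n)
        atTop (𝓝 G) ∧
      Tendsto (fun n => (logGauge w.valuation ((PlaneAut.act f.symm)^[n] z) : ℝ) /
        (f.degree : ℝ) ^ n) atTop (𝓝 G') ∧
      logGauge w.valuation z -
        2 * f.degree * (D.exponent w.point * D.ramification w : ℝ) ≤ G + G' := by
  have : Infinite B.functionField := CharZero.infinite _
  set A : ℤᵐ⁰ := WithZero.exp (D.exponent w.point * D.ramification w) with hA
  have hA1 : 1 ≤ A := D.one_le_exp w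
  have hlogA : ((WithZero.log A : ℤ) : ℝ) = D.exponent w.point * D.ramification w := by
    rw [hA, WithZero.log_exp]
    push_cast
    rfl
  have hα : (0 : ℝ) ≤ (WithZero.log A : ℤ) := by
    rw [hlogA]
    exact mul_nonneg (Nat.cast_nonneg _) (by exact_mod_cast D.ramification_nonneg w)
  have hAp : ∀ i m, w.valuation (algebraMap _ L (coeff m (f.component i))) ≤ A :=
    fun i m => D.valuation_le w (.inl (.inl ⟨(i, m), rfl⟩))
  have hAq : ∀ i m, w.valuation
      (algebraMap _ L (coeff m (PlaneAut.component f.symm i))) ≤ A :=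
    fun i m => D.valuation_le w (.inl (.inr ⟨(i, m), rfl⟩))
  have hAa : ∀ j i n, w.valuation (algebraMap _ L ((a j i).coeff n)) ≤ A :=
    fun j i n => D.valuation_le w (.inr ⟨(j, i, n), rfl⟩)
  have hq : ∀ i, (PlaneAut.component f.symm i).totalDegree ≤ f.degree := fun i =>
    f.degree_symm ▸ PlaneAut.totalDegree_component_le f.symm i
  have hd' : (2 : ℝ) ≤ f.degree := by exact_mod_cast hd
  rw [← hlogA]
  refine ExpandingDynamics.exists_tendsto_and_le_add
    (H := fun z : Fin 2 → L => (logGauge w.valuation z : ℝ)) hd' (by positivity)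
    f.act_symm_act f.act_act_symm
    (fun z => by exact_mod_cast logGauge_nonneg w.valuation z) (fun z => ?_) (fun z => ?_)
    (fun z => ?_) z
  · have := le_logGauge_aeval w.valuation (by omega) f.totalDegree_component_le hq ha hA1 hAp hAq
      hAa z
    exact_mod_cast this
  · have h := logGauge_aeval_le w.valuation f.totalDegree_component_le hA1 hAp z
    have h' : (logGauge w.valuation (f.act z) : ℝ) ≤
        f.degree * logGauge w.valuation z + (WithZero.log A : ℤ) := by exact_mod_cast h
    nlinarith
  · have h := logGauge_aeval_le w.valuation hq hA1 hAq z
    have h' : (logGauge w.valuation (PlaneAut.act f.symm z) : ℝ) ≤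
        f.degree * logGauge w.valuation z + (WithZero.log A : ℤ) := by exact_mod_cast h
    nlinarith

theorem exists_tendsto_heightOver [IsNoetherian B] [CharZero B.functionField]
    [FiniteDimensional B.functionField L] (hB : IsNormalScheme B) (ι : B ⟶ ProjSpace k N)
    (D : DenominatorBound B (coefficientSet f a)) (hd : 2 ≤ f.degree)
    (ha : ∀ j, ∑ i, a j i * chart B.functionField j (homogeneousComponent f.degree
      (Sum.elim f.component (PlaneAut.component f.symm) i)) = 1) (z : Fin 2 → L) :
    ∃ G G' : ℝ,
      Tendsto (fun n => heightOver ι L ![f.act^[n] z 0, f.act^[n] z 1, 1] / (f.degree : ℝ) ^ n)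
        atTop (𝓝 G) ∧
      Tendsto (fun n => heightOver ι L ![(PlaneAut.act f.symm)^[n] z 0,
        (PlaneAut.act f.symm)^[n] z 1, 1] / (f.degree : ℝ) ^ n) atTop (𝓝 G') ∧
      heightOver ι L ![z 0, z 1, 1] - 2 * f.degree * D.degree ι ≤ G + G' := by
  classical
  -- Outside these places `z` and the coefficients of both maps are integral, hence so are the
  -- forward and backward orbits. One finite set therefore serves for every iterate, and the limits
  -- can be taken termwise.
  have hfin : ((⋃ i, {w : DivisorPlace B L | z i ∉ w.ring}) ∪
      ⋃ x ∈ {x | ringKrullDim (B.presheaf.stalk x) = 1 ∧ D.exponent x ≠ 0},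
        {w : DivisorPlace B L | w.point = x}).Finite :=
    (Set.finite_iUnion fun i => DivisorPlace.finite_setOf_notMem_ring hB (z i)).union
      (D.finite.biUnion fun x _ => DivisorPlace.finite_setOf_point_eq hB x)
  set s := hfin.toFinset with hs
  have hz : ∀ w ∉ s, ∀ i, w.valuation (z i) ≤ 1 := by
    intro w hw i
    rw [w.valuation_le_one_iff]
    by_contra h
    exact hw (hfin.mem_toFinset.2 (.inl (Set.mem_iUnion.2 ⟨i, h⟩)))
  have hT : ∀ w ∉ s, ∀ t ∈ coefficientSet f a, w.valuation (algebraMap _ L t) ≤ 1 := by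
    intro w hw t ht
    have h0 : D.exponent w.point = 0 := by
      by_contra h
      exact hw (hfin.mem_toFinset.2 (.inr (Set.mem_biUnion ⟨w.codim_one, h⟩ rfl)))
    simpa [h0] using D.valuation_le w ht
  have hzf : ∀ n, ∀ w ∉ s, ∀ i, w.valuation (f.act^[n] z i) ≤ 1 := fun n w hw =>
    PlaneAut.valuation_iterate_act_le_one w.valuation f
      (fun i m => hT w hw _ (.inl (.inl ⟨(i, m), rfl⟩))) (hz w hw) n
  have hzg : ∀ n, ∀ w ∉ s, ∀ i, w.valuation ((PlaneAut.act f.symm)^[n] z i) ≤ 1 := fun n w hw =>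
    PlaneAut.valuation_iterate_act_le_one w.valuation f.symm
      (fun i m => hT w hw _ (.inl (.inr ⟨(i, m), rfl⟩))) (hz w hw) n
  choose G G' hG hG' hGG using fun w => exists_tendsto_logGauge (L := L) f D hd ha w z
  let c : DivisorPlace B L → ℝ := fun w => (pointDegree (ι w.point) : ℝ) * w.residueDegree
  have hc : ∀ w, 0 ≤ c w := fun w =>
    mul_nonneg (by exact_mod_cast pointDegree_nonneg _) (Nat.cast_nonneg _)
  have hrank : (0 : ℝ) < Module.finrank B.functionField L := by
    exact_mod_cast Module.finrank_pos
  have hdiv : ∀ (x : DivisorPlace B L → ℝ) (r t : ℝ),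
      (∑ w ∈ s, c w * (x w / t)) / r = (∑ w ∈ s, c w * x w) / r / t := by
    intro x r t
    simp only [← mul_div_assoc, ← Finset.sum_div]
    rw [div_right_comm]
  refine ⟨(∑ w ∈ s, c w * G w) / Module.finrank B.functionField L,
    (∑ w ∈ s, c w * G' w) / Module.finrank B.functionField L, ?_, ?_, ?_⟩
  · refine ((tendsto_finsetSum s fun w _ => (hG w).const_mul (c w)).div_const
      (Module.finrank B.functionField L : ℝ)).congr fun n => ?_
    rw [heightOver_eq_sum ι (hzf n), hdiv]
  · refine ((tendsto_finsetSum s fun w _ => (hG' w).const_mul (c w)).div_const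
      (Module.finrank B.functionField L : ℝ)).congr fun n => ?_
    rw [heightOver_eq_sum ι (hzg n), hdiv]
  · have hsum : ∑ w ∈ s, c w * logGauge w.valuation z -
        2 * f.degree * ∑ w ∈ s, c w * (D.exponent w.point * D.ramification w) ≤
        ∑ w ∈ s, c w * G w + ∑ w ∈ s, c w * G' w := by
      rw [Finset.mul_sum, ← Finset.sum_sub_distrib, ← Finset.sum_add_distrib]
      refine Finset.sum_le_sum fun w _ => ?_
      have := mul_le_mul_of_nonneg_left (hGG w) (hc w)
      linarith
    have hD := D.sum_le_degree hB ι s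
    have hD' := mul_le_mul_of_nonneg_left hD (by positivity : (0 : ℝ) ≤ 2 * f.degree)
    rw [heightOver_eq_sum ι hz, ← add_div, sub_le_iff_le_add, div_add' _ _ _ hrank.ne']
    refine div_le_div_of_nonneg_right ?_ hrank.le
    linarith

end FixedField

theorem exists_canonicalHeight_ge {k : Type u} [Field k] [CharZero k] {N : ℕ} (B : Scheme.{u})
    [IsIntegral B] (hB : IsNormalScheme B) (ι : B ⟶ ProjSpace k N) [IsClosedImmersion ι]
    (f : PlaneAut B.functionField) (hreg : f.IsRegular) (hdeg : 2 ≤ f.degree) :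
    ∃ C : ℝ, 0 < C ∧ ∀ z : Fin 2 → AlgebraicClosure B.functionField,
      Tendsto (forwardSeq ι f z) atTop (𝓝 (canonicalHeightPlus ι f z)) ∧
        Tendsto (backwardSeq ι f z) atTop (𝓝 (canonicalHeightMinus ι f z)) ∧
        canonicalHeight ι f z ≥ height ι z - C := by
  have := charZero_functionField ι
  have := isNoetherian_of_isClosedImmersion ι
  have : Infinite B.functionField := CharZero.infinite _
  choose a ha using hreg.exists_sum_mul_eq_one (by omega) rfl f.degree_symm
  obtain ⟨D⟩ := nonempty_denominatorBound hB (finite_coefficientSet f a)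
  have hD := D.degree_nonneg ι
  -- The `+ 1` only ensures strict positivity, since the pole divisor may have degree 0.
  refine ⟨2 * f.degree * D.degree ι + 1, by positivity, fun z => ?_⟩
  let L := IntermediateField.adjoin B.functionField (Set.range z)
  have : FiniteDimensional B.functionField L :=
    IntermediateField.finiteDimensional_adjoin fun x _ => Algebra.IsIntegral.isIntegral x
  let y : Fin 2 → L := fun i => ⟨z i, IntermediateField.subset_adjoin _ _ ⟨i, rfl⟩⟩
  have hy : L.val ∘ y = z := rfl
  obtain ⟨G, G', hG, hG', hGG⟩ := exists_tendsto_heightOver f hB ι D hdeg ha y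
  have hheight : ∀ (g : PlaneAut B.functionField) (n : ℕ),
      height ι (g.act^[n] z) = heightOver ι L ![g.act^[n] y 0, g.act^[n] y 1, 1] := by
    intro g n
    rw [← hy, PlaneAut.iterate_act_map]
    refine height_eq_heightOver ι ?_
    rw [← PlaneAut.iterate_act_map, hy]
    exact g.adjoin_iterate_act z n
  have hf : Tendsto (forwardSeq ι f z) atTop (𝓝 G) :=
    hG.congr fun n => by rw [forwardSeq, hheight]
  have hb : Tendsto (backwardSeq ι f z) atTop (𝓝 G') :=
    hG'.congr fun n => by rw [backwardSeq, hheight f.symm]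
  have hplus : canonicalHeightPlus ι f z = G := hf.limUnder_eq
  have hminus : canonicalHeightMinus ι f z = G' := hb.limUnder_eq
  refine ⟨hplus ▸ hf, hminus ▸ hb, ?_⟩
  have h0 : height ι z = heightOver ι L ![y 0, y 1, 1] := hheight f 0
  rw [canonicalHeight, hplus, hminus, h0]
  linarith

end PlaneDynamics

end

theorem mainTheorem8 {k : Type u} [Field k] [CharZero k] {N : ℕ} (B : Scheme.{u}) [IsIntegral B]
    (hB : PlaneDynamics.IsNormalScheme B) (ι : B ⟶ PlaneDynamics.ProjSpace k N)
    [IsClosedImmersion ι] (f : PlaneDynamics.PlaneAut B.functionField) (hreg : f.IsRegular)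
    (hdeg : 2 ≤ f.degree) :
    ∃ C : ℝ, 0 < C ∧ ∀ z : Fin 2 → AlgebraicClosure B.functionField,
      Tendsto (PlaneDynamics.forwardSeq ι f z) atTop
          (𝓝 (PlaneDynamics.canonicalHeightPlus ι f z)) ∧
        Tendsto (PlaneDynamics.backwardSeq ι f z) atTop
          (𝓝 (PlaneDynamics.canonicalHeightMinus ι f z)) ∧
        PlaneDynamics.canonicalHeight ι f z ≥ PlaneDynamics.height ι z - C := by
  exact PlaneDynamics.exists_canonicalHeight_ge B hB ι f hreg hdeg
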